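/- Let $w$ be Gaussian white noise on $(0,1)$ and let $\phi_1,\phi_2,\dots$ be an orthonormal system in $L_2(0,1)$. For $\varepsilon>0$ and $S\in L_2(0,1)$ we observe $dY_\varepsilon=S\,dt+\varepsilon\,dw$, so that $y_{\varepsilon j}=\int_0^1\phi_j\,dY_\varepsilon=\theta_j+\varepsilon\xi_j$, where $\theta_j=\int_0^1S\phi_j\,dt$ and $\xi_j=\int_0^1\phi_j\,dw$, $j\ge1$. Let $\varkappa_{\varepsilon j}$ be real numbers with $\rho_\varepsilon^2=\sum_{j\ge1}\varkappa_{\varepsilon j}^2<\infty$, and put $$A_\varepsilon=\varepsilon^{-4}\sum_{j\ge1}\varkappa_{\varepsilon j}^4,\quad k_\varepsilon=\sup\Bigl\{k\ge1:\sum_{1\le j<k}\varkappa_{\varepsilon j}^2\le\tfrac12\rho_\varepsilon^2\Bigr\},\quad \varkappa_\varepsilon^2=\varkappa_{\varepsilon k_\varepsilon}^2,$$ $$T_\varepsilon=\varepsilon^{-2}\sum_{j\ge1}\varkappa_{\varepsilon j}^2y_{\varepsilon j}^2-\rho_\varepsilon^2,\quad D_\varepsilon(S)=\varepsilon^{-4}\sum_{j\ge1}\varkappa_{\varepsilon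 j}^2\theta_j^2,\quad B_\varepsilon(S)=\frac{D_\varepsilon(S)}{(2A_\varepsilon)^{1/2}}.$$ For a family of thresholds $x_\varepsilon\in\mathbb R$ let $L_\varepsilon=\mathbf 1\{\varepsilon^{-2}(2A_\varepsilon)^{-1/2}T_\varepsilon>x_\varepsilon\}$, and let $\alpha(L_\varepsilon)=\mathbf E_0L_\varepsilon$ and $\beta(L_\varepsilon,S)=\mathbf E_S(1-L_\varepsilon)$ be its type I and type II error probabilities. Let $\Phi$ be the standard normal distribution function and $[a]$ the integer part of $a$. Assume: A1. For each $\varepsilon>0$ the sequence $(\varkappa_{\varepsilon j}^2)_{j\ge1}$ is nonincreasing. A2. There are constants $0<C_1<C_2$ with $C_1<A_\varepsilon<C_2$ for all $\varepsilon>0$. A3. There are $C_1$ and $\lambda>1$ such that $\varkappa^2_{\varepsilon,[(1+\delta)k_\varepsilon]}<C_1(1+\delta)^{-\lambda}\varkappa_\varepsilon^2$ for all $\delta>0$, $\varepsilon>0$. A4. $\varkappa_{\varepsilon1}^2\asymp\varkappa_\varepsilon^2$ as $\varepsilon\to0$, and for every $c>1$ there is $C>0$ with $\varkappa^2_{\varepsilon,[ck_\varepsilon]}\ge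 C\varkappa_\varepsilon^2$ for all $\varepsilon>0$. All limits are as $\varepsilon\to0$, $\varepsilon>0$. For families of reals, in conditions 2, 4 and 5, $f_\varepsilon=O(g_\varepsilon)$ means that $f_\varepsilon\le Cg_\varepsilon$ for some constant $C>0$ and all small $\varepsilon$, and $f_\varepsilon=\Omega(g_\varepsilon)$ means $g_\varepsilon=O(f_\varepsilon)$. Let $S_\varepsilon\in L_2(0,1)$, $\varepsilon>0$, and write $B_\varepsilon=B_\varepsilon(S_\varepsilon)$, $D_\varepsilon=D_\varepsilon(S_\varepsilon)$. Then: 1. If $x_\varepsilon\to\infty$ and $x_\varepsilon=o(k_\varepsilon^{1/6})$, then $\alpha(L_\varepsilon)=(1-\Phi(x_\varepsilon))(1+o(1))$. 2. If $\alpha(L_\varepsilon)\to0$, $x_\varepsilon=O(B_\varepsilon)$, $D_\varepsilon\to\infty$, $D_\varepsilon=o(k_\varepsilon^{1/6})$ and $B_\varepsilon-x_\varepsilon=\Omega(B_\varepsilon)$, then $\beta(L_\varepsilon,S_\varepsilon)=\Phi(x_\varepsilon-B_\varepsilon)(1+o(1))$. 3. If $x_\varepsilon\to\infty$ and $x_\varepsilon=o(k_\varepsilon^{1/2})$,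 then $\sqrt{2|\log\alpha(L_\varepsilon)|}=x_\varepsilon(1+o(1))$ and $\alpha(L_\varepsilon)\to0$. 4. If $\alpha(L_\varepsilon)\to0$, $x_\varepsilon=O(B_\varepsilon)$, $D_\varepsilon\to\infty$, $D_\varepsilon=o(k_\varepsilon^{1/2})$ and $B_\varepsilon-x_\varepsilon=\Omega(B_\varepsilon)$, then $\sqrt{2|\log\beta(L_\varepsilon,S_\varepsilon)|}=(B_\varepsilon-x_\varepsilon)(1+o(1))$. 5. If $\alpha(L_\varepsilon)\to0$, $x_\varepsilon=O(B_\varepsilon)$, $r_\varepsilon\to\infty$, $r_\varepsilon=O(k_\varepsilon^{1/2})$, $B_\varepsilon/r_\varepsilon\to\infty$ and $B_\varepsilon-x_\varepsilon=\Omega(B_\varepsilon)$, then $r_\varepsilon^{-2}|\log\beta(L_\varepsilon,S_\varepsilon)|\to\infty$. -/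

import Mathlib

open MeasureTheory ProbabilityTheory Filter Topology Asymptotics

noncomputable section

namespace NeymanTest

/-- The space `L₂(0,1)` of signals. -/
abbrev Signal : Type := Lp ℝ 2 (volume.restrict (Set.Ioo (0 : ℝ) 1))

/-- Gaussian white noise on `(0,1)`: `W f` is the stochastic integral `∫₀¹ f dw`, that is, `W` is a
centred Gaussian process indexed by `L₂(0,1)` whose covariance is the inner product. -/
structure IsGaussianWhiteNoise {Ω : Type*} [MeasurableSpace Ω] (W : Signal → Ω → ℝ)
    (P : Measure Ω) : Prop where
  isGaussianProcess : IsGaussianProcess W P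
  mean_eq_zero : ∀ f : Signal, ∫ ω, W f ω ∂P = 0
  covariance_eq : ∀ f g : Signal, cov[W f, W g; P] = inner ℝ f g

/-- Fourier coefficient `θ_j = ∫₀¹ S φ_j dt`. -/
def fourierCoeff (φ : ℕ → Signal) (S : Signal) (j : ℕ) : ℝ := inner ℝ (φ j) S

/-- The observation `y_{εj} = ∫₀¹ φ_j dY_ε = θ_j + ε ξ_j`, where `dY_ε = S dt + ε dw` and
`ξ_j = ∫₀¹ φ_j dw`. -/
def observation {Ω : Type*} (W : Signal → Ω → ℝ) (φ : ℕ → Signal) (ε : ℝ) (S : Signal)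
    (ω : Ω) (j : ℕ) : ℝ :=
  fourierCoeff φ S j + ε * W (φ j) ω

/-! Coefficients are `κ : ℝ → ℕ → ℝ`, with `κ ε j` standing for `ϰ_{εj}`, `j ≥ 1`. The value at
`j = 0` is never used; a sum over `j ≥ 1` is written as a sum over `j : ℕ` of the `(j+1)`-st term. -/

/-- `ρ_ε² = ∑_{j ≥ 1} ϰ_{εj}²`. -/
def rhoSq (κ : ℝ → ℕ → ℝ) (ε : ℝ) : ℝ := ∑' j : ℕ, κ ε (j + 1) ^ 2

/-- `A_ε = ε⁻⁴ ∑_{j ≥ 1} ϰ_{εj}⁴`. -/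
def A (κ : ℝ → ℕ → ℝ) (ε : ℝ) : ℝ := (ε ^ 4)⁻¹ * ∑' j : ℕ, κ ε (j + 1) ^ 4

/-- `k_ε = sup {k ≥ 1 : ∑_{1 ≤ j < k} ϰ_{εj}² ≤ ρ_ε² / 2}`. -/
def kIndex (κ : ℝ → ℕ → ℝ) (ε : ℝ) : ℕ :=
  sSup {k : ℕ | 1 ≤ k ∧ ∑ j ∈ Finset.Ico 1 k, κ ε j ^ 2 ≤ rhoSq κ ε / 2}

/-- `ϰ_ε² = ϰ_{ε k_ε}²`. -/
def kappaSq (κ : ℝ → ℕ → ℝ) (ε : ℝ) : ℝ := κ ε (kIndex κ ε) ^ 2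

/-- Assumption A1: for each `ε` the sequence `ϰ_{εj}²`, `j ≥ 1`, is nonincreasing. -/
def AssumptionA1 (κ : ℝ → ℕ → ℝ) : Prop :=
  ∀ ε > 0, AntitoneOn (fun j : ℕ => κ ε j ^ 2) (Set.Ici 1)

/-- Assumption A2: `A_ε` is bounded away from zero and infinity. -/
def AssumptionA2 (κ : ℝ → ℕ → ℝ) : Prop :=
  ∃ C₁ C₂ : ℝ, 0 < C₁ ∧ ∀ ε > 0, C₁ < A κ ε ∧ A κ ε < C₂

/-- Assumption A3: `ϰ²_{ε,[(1+δ)k_ε]} < C₁ (1+δ)^{-λ} ϰ_ε²` for some `C₁` and `λ > 1`. -/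
def AssumptionA3 (κ : ℝ → ℕ → ℝ) : Prop :=
  ∃ C₁ l : ℝ, 1 < l ∧ ∀ δ > (0 : ℝ), ∀ ε > 0,
    κ ε ⌊(1 + δ) * (kIndex κ ε : ℝ)⌋₊ ^ 2 < C₁ * (1 + δ) ^ (-l) * kappaSq κ ε

/-- Assumption A4: `ϰ_{ε1}² ≍ ϰ_ε²` as `ε → 0`, and for every `c > 1` there is `C > 0` with
`ϰ²_{ε,[c k_ε]} ≥ C ϰ_ε²` for all `ε > 0`. -/
def AssumptionA4 (κ : ℝ → ℕ → ℝ) : Prop :=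
  (fun ε => κ ε 1 ^ 2) =Θ[𝓝[>] 0] (fun ε => kappaSq κ ε) ∧
  ∀ c > (1 : ℝ), ∃ C > (0 : ℝ), ∀ ε > 0,
    C * kappaSq κ ε ≤ κ ε ⌊c * (kIndex κ ε : ℝ)⌋₊ ^ 2

/-- The statistic `T_ε(y) = ε⁻² ∑_{j ≥ 1} ϰ_{εj}² y_j² - ρ_ε²`. -/
def statistic (κ : ℝ → ℕ → ℝ) (ε : ℝ) (y : ℕ → ℝ) : ℝ :=
  (ε ^ 2)⁻¹ * (∑' j : ℕ, κ ε (j + 1) ^ 2 * y (j + 1) ^ 2) - rhoSq κ ε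

/-- The Neyman-type test with threshold `x`: it rejects (takes the value `1`) when the statistic
standardized by its null variance `2 ε⁴ A_ε`, i.e. `ε⁻² (2 A_ε)^{-1/2} T_ε`, exceeds `x`. -/
def test (κ : ℝ → ℕ → ℝ) (ε x : ℝ) (y : ℕ → ℝ) : ℝ :=
  Set.indicator {z : ℕ → ℝ | x < (ε ^ 2)⁻¹ * (√(2 * A κ ε))⁻¹ * statistic κ ε z} (fun _ => 1) y

/-- Type I error probability `α(L_ε) = E₀ L_ε`. -/
def typeI {Ω : Type*} [MeasurableSpace Ω] (P : Measure Ω) (W : Signal → Ω → ℝ) (φ : ℕ → Signal)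
    (κ : ℝ → ℕ → ℝ) (ε x : ℝ) : ℝ :=
  ∫ ω, test κ ε x (observation W φ ε 0 ω) ∂P

/-- Type II error probability `β(L_ε, S) = E_S (1 - L_ε)`. -/
def typeII {Ω : Type*} [MeasurableSpace Ω] (P : Measure Ω) (W : Signal → Ω → ℝ) (φ : ℕ → Signal)
    (κ : ℝ → ℕ → ℝ) (ε x : ℝ) (S : Signal) : ℝ :=
  ∫ ω, (1 - test κ ε x (observation W φ ε S ω)) ∂P

/-- `D_ε(S) = ε⁻⁴ ∑_{j ≥ 1} ϰ_{εj}² θ_j²`. -/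
def D (φ : ℕ → Signal) (κ : ℝ → ℕ → ℝ) (ε : ℝ) (S : Signal) : ℝ :=
  (ε ^ 4)⁻¹ * ∑' j : ℕ, κ ε (j + 1) ^ 2 * fourierCoeff φ S (j + 1) ^ 2

/-- `B_ε(S) = D_ε(S) / (2 A_ε)^{1/2}`. -/
def B (φ : ℕ → Signal) (κ : ℝ → ℕ → ℝ) (ε : ℝ) (S : Signal) : ℝ :=
  D φ κ ε S / √(2 * A κ ε)

/-- The standard normal distribution function `Φ`. -/
def Phi (x : ℝ) : ℝ := cdf (gaussianReal 0 1) x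

/-- The one-sided order relation `f ≤ C g` for small `ε > 0`, with some constant `C > 0`.
Thus `f = O(g)` is `OrderLE f g`, and `f = Ω(g)` is `OrderLE g f`. -/
def OrderLE (f g : ℝ → ℝ) : Prop := ∃ C > (0 : ℝ), ∀ᶠ ε in 𝓝[>] 0, f ε ≤ C * g ε

end NeymanTest

end

/-! After standardization the statistic is `B` plus a centred quadratic form `∑ b_j ((ξ_j + τ_j)² -
1 - τ_j²)` in independent standard normals. Its weights satisfy `∑ b_j² = 1/2`, and its
noncentralities `d_j = b_j τ_j²` sum to `B` (`standardized_statistic_eq`, `isWeightSystem`). Type I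
error is a right tail of this form with `B = 0`; type II error is a left tail at distance `y = B -
x`.

The only small parameter is the largest weight `β = b_0`. Monotonicity and A4 give `β = O(k^{-1/2})`
(`exists_weight_zero_mul_le`). Expanding the logarithm of the Laplace transform yields `K(z) = z²/2
+ O(β(|z|³ + |z|² B))` for `|z| β ≤ 1/4` (`IsWeightSystem.norm_cumulant_sub_le`), and `NearGaussian`
records what the tail estimates need. For tails at `y ≤ B`, the error is negligible when `β B³ → 0`,
and negligible relative to `y²` when `y` is comparable to `B` and `β B → 0`; hence the powers
`k^{1/6}` and `k^{1/2}`.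

The sharp asymptotics (`isEquivalent_tail`) compare Laplace transforms on the line `Re z = y`, the
saddle point of the Gaussian integral. Fourier inversion bounds the difference of two tails by `y⁻¹
e^{-y²}` times the integrated difference of the transforms, while the normal tail is at least of
order `y⁻¹ e^{-y²/2}`. The integral is `o(e^{y²/2})` by dominated convergence:
`IsWeightSystem.re_cumulant_le` gives decay along vertical lines that is uniform in the weights.

The logarithmic asymptotics (`tendsto_log_tail_div_sq`) use Chernoff's bound from above and
exponential tilting from below. For still larger signals, Chernoff's bound at a small multiple of
`r` suffices. -/

namespace NeymanTest

open scoped FourierTransform Real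
open Complex (I)

/-! ### Comparison of tail probabilities through moment generating functions -/

/-- A continuous approximation of the one-sided exponential `v ↦ e^{-tv} 1{v > 0}`. -/
noncomputable def expKernel (t m v : ℝ) : ℝ :=
  Real.exp (-t * max v 0) - Real.exp (-(t + m) * max v 0)

lemma continuous_expKernel (t m : ℝ) : Continuous (expKernel t m) := by
  unfold expKernel; fun_prop

lemma expKernel_eq_indicator (t m : ℝ) :
    (fun v => (expKernel t m v : ℂ)) = Set.indicator (Set.Ioi 0)
      (fun v : ℝ => Complex.exp ((-t : ℂ) * v) - Complex.exp ((-(t + m) : ℂ) * v)) := by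
  ext v
  by_cases hv : 0 < v
  · rw [Set.indicator_of_mem (Set.mem_Ioi.2 hv), expKernel, max_eq_left hv.le]
    push_cast
    rfl
  · rw [Set.indicator_of_notMem (by simpa using hv), expKernel, max_eq_right (not_lt.1 hv)]
    simp

lemma integrable_expKernel {t m : ℝ} (ht : 0 < t) (hm : 0 ≤ m) :
    Integrable (fun v => (expKernel t m v : ℂ)) := by
  rw [expKernel_eq_indicator, integrable_indicator_iff measurableSet_Ioi]
  refine (integrableOn_exp_mul_complex_Ioi ?_ 0).sub (integrableOn_exp_mul_complex_Ioi ?_ 0)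
  · simpa using ht
  · simp only [Complex.neg_re, Complex.add_re, Complex.ofReal_re]; linarith

lemma fourier_expKernel {t m : ℝ} (ht : 0 < t) (hm : 0 ≤ m) (w : ℝ) :
    𝓕 (fun v => (expKernel t m v : ℂ)) w =
      1 / (t + 2 * π * w * I) - 1 / (t + m + 2 * π * w * I) := by
  have h1 : (-(t + 2 * π * w * I) : ℂ).re < 0 := by simpa using ht
  have h2 : (-(t + m + 2 * π * w * I) : ℂ).re < 0 := by simp; linarith
  rw [Real.fourier_real_eq_integral_exp_smul]
  change ∫ v : ℝ, Complex.exp (↑(-2 * π * v * w) * I) • (fun v => (expKernel t m v : ℂ)) v = _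
  rw [expKernel_eq_indicator]
  have : ∀ v : ℝ, Complex.exp (↑(-2 * π * v * w) * I) • Set.indicator (Set.Ioi 0)
      (fun v : ℝ => Complex.exp ((-t : ℂ) * v) - Complex.exp ((-(t + m) : ℂ) * v)) v =
      Set.indicator (Set.Ioi 0) (fun v : ℝ => Complex.exp (-(t + 2 * π * w * I) * v) -
        Complex.exp (-(t + m + 2 * π * w * I) * v)) v := by
    intro v
    by_cases hv : v ∈ Set.Ioi (0 : ℝ)
    · simp only [Set.indicator_of_mem hv, smul_eq_mul, mul_sub, ← Complex.exp_add]
      congr 2 <;> push_cast <;> ring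
    · simp only [Set.indicator_of_notMem hv, smul_zero]
  simp_rw [this]
  rw [integral_indicator measurableSet_Ioi, integral_sub
    (integrableOn_exp_mul_complex_Ioi h1 0) (integrableOn_exp_mul_complex_Ioi h2 0),
    integral_exp_mul_complex_Ioi h1, integral_exp_mul_complex_Ioi h2]
  simp only [Complex.ofReal_zero, mul_zero, Complex.exp_zero, neg_div_neg_eq]

/-- The transform equals `m / (a b)` with `a = t + 2πiw`, `b = a + m`. The first bound is uniform in
`m` and survives `m → ∞`; the second gives the integrability that Fourier inversion requires. -/
lemma norm_fourier_expKernel_le {t m : ℝ} (ht : 0 < t) (hm : 0 ≤ m) (w : ℝ) :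
    ‖𝓕 (fun v => (expKernel t m v : ℂ)) w‖ ≤ t⁻¹ ∧
    ‖𝓕 (fun v => (expKernel t m v : ℂ)) w‖ ≤ m * (t ^ 2 + (2 * π * w) ^ 2)⁻¹ := by
  set a : ℂ := t + 2 * π * w * I with ha
  set b : ℂ := t + m + 2 * π * w * I with hb
  have hna : ‖a‖ ^ 2 = t ^ 2 + (2 * π * w) ^ 2 := by
    rw [← Complex.normSq_eq_norm_sq, Complex.normSq_apply]; simp [ha]; ring
  have hnb : ‖b‖ ^ 2 = (t + m) ^ 2 + (2 * π * w) ^ 2 := by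
    rw [← Complex.normSq_eq_norm_sq, Complex.normSq_apply]; simp [hb]; ring
  have hat : t ≤ ‖a‖ := by
    refine le_of_sq_le_sq ?_ (norm_nonneg _)
    rw [hna]; nlinarith [sq_nonneg (2 * π * w)]
  have hbm : t + m ≤ ‖b‖ := by
    refine le_of_sq_le_sq ?_ (norm_nonneg _)
    rw [hnb]; nlinarith [sq_nonneg (2 * π * w)]
  have hab : ‖a‖ ≤ ‖b‖ := by
    refine le_of_sq_le_sq ?_ (norm_nonneg _)
    rw [hna, hnb]; nlinarith
  have hapos : 0 < ‖a‖ := ht.trans_le hat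
  have hbpos : 0 < ‖b‖ := hapos.trans_le hab
  have ha0 : a ≠ 0 := norm_pos_iff.1 hapos
  have hb0 : b ≠ 0 := norm_pos_iff.1 hbpos
  have hF : ‖𝓕 (fun v => (expKernel t m v : ℂ)) w‖ = m / (‖a‖ * ‖b‖) := by
    rw [fourier_expKernel ht hm, ← ha, ← hb, div_sub_div _ _ ha0 hb0, norm_div, norm_mul]
    congr 1
    have : (1 * b - a * 1 : ℂ) = (m : ℂ) := by rw [ha, hb]; ring
    rw [this, Complex.norm_real, Real.norm_of_nonneg hm]
  rw [hF, ← hna]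
  constructor
  · rw [div_le_iff₀ (by positivity), inv_mul_eq_div, le_div_iff₀ ht]
    nlinarith
  · rw [← div_eq_mul_inv]
    gcongr
    nlinarith

lemma integrable_fourier_expKernel {t m : ℝ} (ht : 0 < t) (hm : 0 ≤ m) :
    Integrable (𝓕 (fun v => (expKernel t m v : ℂ))) := by
  have hint : Integrable fun w : ℝ => m * (t ^ 2)⁻¹ * (1 + (2 * π / t * w) ^ 2)⁻¹ :=
    (integrable_inv_one_add_sq.comp_mul_left' (by positivity)).const_mul _
  have hmeas : AEStronglyMeasurable (𝓕 (fun v => (expKernel t m v : ℂ))) := by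
    have : 𝓕 (fun v => (expKernel t m v : ℂ)) = fun w : ℝ =>
      (1 / (t + 2 * π * w * I) - 1 / (t + m + 2 * π * w * I) : ℂ) :=
      funext fun w => fourier_expKernel ht hm w
    rw [this]
    exact Measurable.aestronglyMeasurable (by fun_prop)
  refine hint.mono' hmeas (ae_of_all _ fun w => ?_)
  refine (norm_fourier_expKernel_le ht hm w).2.trans_eq ?_
  field_simp

lemma expKernel_eq_integral {t m : ℝ} (ht : 0 < t) (hm : 0 ≤ m) (v : ℝ) :
    (expKernel t m v : ℂ) = ∫ w : ℝ, Complex.exp ((2 * π * w * I) * v) *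
      𝓕 (fun v => (expKernel t m v : ℂ)) w := by
  have h := congrFun (Continuous.fourierInv_fourier_eq
    (Complex.continuous_ofReal.comp (continuous_expKernel t m)) (integrable_expKernel ht hm)
    (integrable_fourier_expKernel ht hm)) v
  refine h.symm.trans ?_
  rw [Real.fourierInv_eq']
  refine integral_congr_ae (ae_of_all _ fun w => ?_)
  simp only [smul_eq_mul]
  congr 2
  simp
  ring

variable {Ω Ω' : Type*} [MeasurableSpace Ω] [MeasurableSpace Ω']

/-- Fourier inversion of the kernel followed by Fubini; the factor `e^{tX}` moves the frequency
integral from the imaginary axis to the line `Re z = t`. -/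
lemma integral_exp_mul_expKernel {P : Measure Ω} [IsFiniteMeasure P] {X : Ω → ℝ}
    (hX : AEMeasurable X P) {t m : ℝ} (ht : 0 < t) (hm : 0 ≤ m) (y : ℝ)
    (hint : Integrable (fun ω => Real.exp (t * X ω)) P) :
    ((∫ ω, Real.exp (t * X ω) * expKernel t m (X ω - y) ∂P : ℝ) : ℂ) =
      ∫ w : ℝ, 𝓕 (fun v => (expKernel t m v : ℂ)) w *
        (Complex.exp (-(2 * π * w * y : ℝ) * I) * complexMGF X P (t + (2 * π * w : ℝ) * I)) := by
  set F := 𝓕 (fun v => (expKernel t m v : ℂ)) with hF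
  have key : ∀ ω, ((Real.exp (t * X ω) * expKernel t m (X ω - y) : ℝ) : ℂ) =
      ∫ w : ℝ, Complex.exp (t * X ω) *
        (Complex.exp ((2 * π * w * I) * ((X ω - y : ℝ) : ℂ)) * F w) := by
    intro ω
    rw [integral_const_mul, ← expKernel_eq_integral ht hm]
    push_cast
    rfl
  rw [← integral_complex_ofReal]
  simp_rw [key]
  rw [integral_integral_swap]
  · refine integral_congr_ae (ae_of_all _ fun w => ?_)
    simp only [complexMGF]
    rw [← integral_const_mul, ← integral_const_mul]
    refine integral_congr_ae (ae_of_all _ fun ω => ?_)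
    simp only
    rw [← mul_assoc, ← Complex.exp_add, ← Complex.exp_add, mul_comm]
    congr 2
    push_cast
    ring
  · have hprod : Integrable (fun p : Ω × ℝ => Real.exp (t * X p.1) * ‖F p.2‖) (P.prod volume) :=
      hint.mul_prod (integrable_fourier_expKernel ht hm).norm
    refine hprod.mono' ?_ (ae_of_all _ fun p => ?_)
    · have h1 : AEMeasurable (fun p : Ω × ℝ => X p.1) (P.prod volume) := hX.comp_fst
      have h2 : AEStronglyMeasurable (fun p : Ω × ℝ => F p.2) (P.prod volume) :=
        (integrable_fourier_expKernel ht hm).aestronglyMeasurable.comp_snd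
      simp only [Function.uncurry_def]
      refine AEStronglyMeasurable.mul ?_ (AEStronglyMeasurable.mul ?_ h2)
      · exact AEMeasurable.aestronglyMeasurable (by fun_prop)
      · exact AEMeasurable.aestronglyMeasurable (by fun_prop)
    · simp only [Function.uncurry_def, norm_mul, Complex.norm_exp]
      simp

lemma expKernel_nonneg {t m : ℝ} (hm : 0 ≤ m) (v : ℝ) : 0 ≤ expKernel t m v := by
  rw [expKernel, sub_nonneg, Real.exp_le_exp]
  nlinarith [le_max_right v 0]

lemma expKernel_le_one {t m : ℝ} (ht : 0 ≤ t) (v : ℝ) : expKernel t m v ≤ 1 := by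
  have : Real.exp (-t * max v 0) ≤ 1 := by
    rw [Real.exp_le_one_iff]; nlinarith [le_max_right v 0]
  rw [expKernel]
  linarith [Real.exp_pos (-(t + m) * max v 0)]

/-- As `m → ∞` the integrand tends to `e^{tX} e^{-t(X-y)} = e^{ty}` where `X > y`. It vanishes at `X
= y` for every `m`, so the limit sees the open half-line. -/
lemma tendsto_integral_exp_mul_expKernel {P : Measure Ω} [IsFiniteMeasure P] {X : Ω → ℝ}
    (hX : AEMeasurable X P) {t : ℝ} (ht : 0 < t) (y : ℝ)
    (hint : Integrable (fun ω => Real.exp (t * X ω)) P) :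
    Tendsto (fun m : ℕ => ∫ ω, Real.exp (t * X ω) * expKernel t m (X ω - y) ∂P) atTop
      (𝓝 (Real.exp (t * y) * P.real {ω | y < X ω})) := by
  have hms : NullMeasurableSet {ω | y < X ω} P := nullMeasurableSet_lt aemeasurable_const hX
  have hlim : Real.exp (t * y) * P.real {ω | y < X ω} =
      ∫ ω, Set.indicator {ω | y < X ω} (fun _ => Real.exp (t * y)) ω ∂P := by
    rw [integral_indicator₀ hms, setIntegral_const, smul_eq_mul, mul_comm]
  rw [hlim]
  refine tendsto_integral_of_dominated_convergence (fun ω => Real.exp (t * X ω)) ?_ hint ?_ ?_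
  · intro m
    have := (continuous_expKernel t m).measurable
    exact AEMeasurable.aestronglyMeasurable (by fun_prop)
  · intro m
    refine ae_of_all _ fun ω => ?_
    rw [norm_mul, Real.norm_of_nonneg (Real.exp_pos _).le,
      Real.norm_of_nonneg (expKernel_nonneg (Nat.cast_nonneg m) _)]
    exact mul_le_of_le_one_right (Real.exp_pos _).le (expKernel_le_one ht.le _)
  · refine ae_of_all _ fun ω => ?_
    by_cases hω : y < X ω
    · rw [Set.indicator_of_mem (by exact hω)]
      have hpos : 0 < X ω - y := sub_pos.2 hω
      have h1 : Tendsto (fun m : ℕ => Real.exp (-(t + m) * (X ω - y))) atTop (𝓝 0) := by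
        refine Real.tendsto_exp_atBot.comp ?_
        refine Tendsto.atBot_mul_const hpos (tendsto_neg_atTop_atBot.comp ?_)
        exact tendsto_atTop_add_const_left _ _ tendsto_natCast_atTop_atTop
      have h2 := ((tendsto_const_nhds (x := Real.exp (-t * (X ω - y)))).sub h1).const_mul
        (Real.exp (t * X ω))
      rw [sub_zero, ← Real.exp_add] at h2
      simp only [expKernel, max_eq_left hpos.le]
      convert h2 using 3
      ring
    · rw [Set.indicator_of_notMem (by exact hω)]
      simp [expKernel, max_eq_right (sub_nonpos.2 (not_lt.1 hω))]

lemma aestronglyMeasurable_complexMGF {P : Measure Ω} [SFinite P] {X : Ω → ℝ}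
    (hX : AEMeasurable X P) (t : ℝ) :
    AEStronglyMeasurable fun w : ℝ => complexMGF X P (t + (2 * π * w : ℝ) * I) := by
  simp only [complexMGF]
  have h1 : AEMeasurable (fun p : ℝ × Ω => X p.2) (volume.prod P) := hX.comp_snd
  have : AEStronglyMeasurable (fun p : ℝ × Ω =>
      Complex.exp ((t + (2 * π * p.1 : ℝ) * I) * X p.2)) (volume.prod P) :=
    AEMeasurable.aestronglyMeasurable (by fun_prop)
  exact this.integral_prod_right'

lemma integrable_fourier_expKernel_mul_complexMGF {P : Measure Ω} [IsFiniteMeasure P]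
    {X : Ω → ℝ} (hX : AEMeasurable X P) {t m : ℝ} (ht : 0 < t) (hm : 0 ≤ m) (y : ℝ) :
    Integrable fun w : ℝ => 𝓕 (fun v => (expKernel t m v : ℂ)) w *
      (Complex.exp (-(2 * π * w * y : ℝ) * I) * complexMGF X P (t + (2 * π * w : ℝ) * I)) := by
  refine (integrable_fourier_expKernel ht hm).mul_bdd (c := mgf X P t) ?_ (ae_of_all _ ?_)
  · exact AEStronglyMeasurable.mul (Measurable.aestronglyMeasurable (by fun_prop))
      (aestronglyMeasurable_complexMGF hX t)
  · intro w
    rw [norm_mul]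
    have h1 : ‖Complex.exp (-(2 * π * w * y : ℝ) * I)‖ = 1 := by
      rw [← Complex.ofReal_neg]; exact Complex.norm_exp_ofReal_mul_I _
    rw [h1, one_mul]
    simpa using norm_complexMGF_le_mgf (X := X) (μ := P) (z := t + (2 * π * w : ℝ) * I)

/-- Two tail probabilities are close if the moment generating functions are close in mean on a
vertical line. -/
theorem abs_sub_measureReal_lt_le {P : Measure Ω} [IsFiniteMeasure P]
    {P' : Measure Ω'} [IsFiniteMeasure P'] {X : Ω → ℝ} {X' : Ω' → ℝ}
    (hX : AEMeasurable X P) (hX' : AEMeasurable X' P') {t : ℝ} (ht : 0 < t) (y : ℝ)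
    (hint : Integrable (fun ω => Real.exp (t * X ω)) P)
    (hint' : Integrable (fun ω => Real.exp (t * X' ω)) P')
    (hdiff : Integrable fun w : ℝ => complexMGF X P (t + (2 * π * w : ℝ) * I) -
      complexMGF X' P' (t + (2 * π * w : ℝ) * I)) :
    t * Real.exp (t * y) * |P.real {ω | y < X ω} - P'.real {ω | y < X' ω}| ≤
      ∫ w : ℝ, ‖complexMGF X P (t + (2 * π * w : ℝ) * I) -
        complexMGF X' P' (t + (2 * π * w : ℝ) * I)‖ := by
  set M := fun w : ℝ => complexMGF X P (t + (2 * π * w : ℝ) * I)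
  set M' := fun w : ℝ => complexMGF X' P' (t + (2 * π * w : ℝ) * I)
  have hbound : ∀ m : ℕ, |(∫ ω, Real.exp (t * X ω) * expKernel t m (X ω - y) ∂P) -
      ∫ ω, Real.exp (t * X' ω) * expKernel t m (X' ω - y) ∂P'| ≤ t⁻¹ * ∫ w, ‖M w - M' w‖ := by
    intro m
    have hm : (0 : ℝ) ≤ m := Nat.cast_nonneg m
    rw [← Real.norm_eq_abs, ← Complex.norm_real, Complex.ofReal_sub,
      integral_exp_mul_expKernel hX ht hm y hint, integral_exp_mul_expKernel hX' ht hm y hint',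
      ← integral_sub (integrable_fourier_expKernel_mul_complexMGF hX ht hm y)
        (integrable_fourier_expKernel_mul_complexMGF hX' ht hm y), ← integral_const_mul]
    refine norm_integral_le_of_norm_le (hdiff.norm.const_mul _) (ae_of_all _ fun w => ?_)
    rw [← mul_sub, ← mul_sub, norm_mul, norm_mul]
    have h1 : ‖Complex.exp (-(2 * π * w * y : ℝ) * I)‖ = 1 := by
      rw [← Complex.ofReal_neg]; exact Complex.norm_exp_ofReal_mul_I _
    rw [h1, one_mul]
    gcongr
    exact (norm_fourier_expKernel_le ht hm w).1
  -- The bound does not depend on `m`, so it passes to the limit that restores the indicator.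
  have hlim := le_of_tendsto (((tendsto_integral_exp_mul_expKernel hX ht y hint).sub
    (tendsto_integral_exp_mul_expKernel hX' ht y hint')).abs) (Eventually.of_forall hbound)
  rw [← mul_sub, abs_mul, abs_of_pos (Real.exp_pos _), inv_mul_eq_div, le_div_iff₀ ht] at hlim
  linarith

lemma tendsto_measureReal_lt {P : Measure Ω} [IsFiniteMeasure P] {X : Ω → ℝ}
    (hX : AEMeasurable X P) {u : ℕ → ℝ} {y : ℝ} (hu_mono : Monotone u) (hu_lt : ∀ n, u n < y)
    (hu : Tendsto u atTop (𝓝 y)) :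
    Tendsto (fun n => P.real {ω | u n < X ω}) atTop (𝓝 (P.real {ω | y ≤ X ω})) := by
  have hset : {ω | y ≤ X ω} = ⋂ n, {ω | u n < X ω} := by
    ext ω
    simp only [Set.mem_ofPred_eq, Set.mem_iInter]
    exact ⟨fun h n => (hu_lt n).trans_le h, fun h => le_of_tendsto' hu fun n => (h n).le⟩
  rw [hset]
  refine (ENNReal.tendsto_toReal (measure_ne_top _ _)).comp (tendsto_measure_iInter_atTop
    (fun n => nullMeasurableSet_lt aemeasurable_const hX) ?_ ⟨0, measure_ne_top _ _⟩)
  exact fun i j hij ω hω => (hu_mono hij).trans_lt hω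

/-- The version of `abs_sub_measureReal_lt_le` for closed half-lines. -/
theorem abs_sub_measureReal_le_le {P : Measure Ω} [IsFiniteMeasure P]
    {P' : Measure Ω'} [IsFiniteMeasure P'] {X : Ω → ℝ} {X' : Ω' → ℝ}
    (hX : AEMeasurable X P) (hX' : AEMeasurable X' P') {t : ℝ} (ht : 0 < t) (y : ℝ)
    (hint : Integrable (fun ω => Real.exp (t * X ω)) P)
    (hint' : Integrable (fun ω => Real.exp (t * X' ω)) P')
    (hdiff : Integrable fun w : ℝ => complexMGF X P (t + (2 * π * w : ℝ) * I) -
      complexMGF X' P' (t + (2 * π * w : ℝ) * I)) :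
    t * Real.exp (t * y) * |P.real {ω | y ≤ X ω} - P'.real {ω | y ≤ X' ω}| ≤
      ∫ w : ℝ, ‖complexMGF X P (t + (2 * π * w : ℝ) * I) -
        complexMGF X' P' (t + (2 * π * w : ℝ) * I)‖ := by
  -- The closed half-line is the decreasing intersection of open ones with thresholds increasing to
  -- `y`.
  obtain ⟨u, hu_mono, hu_lt, hu⟩ := exists_seq_strictMono_tendsto y
  have h1 : Tendsto (fun n => t * Real.exp (t * u n)) atTop (𝓝 (t * Real.exp (t * y))) :=
    ((Real.continuous_exp.tendsto _).comp (hu.const_mul t)).const_mul t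
  exact le_of_tendsto' (h1.mul ((tendsto_measureReal_lt hX hu_mono.monotone hu_lt hu).sub
    (tendsto_measureReal_lt hX' hu_mono.monotone hu_lt hu)).abs)
    fun n => abs_sub_measureReal_lt_le hX hX' ht (u n) hint hint' hdiff

end NeymanTest

namespace NeymanTest

open scoped Real
open Complex (I)

/-! ### The cumulant generating function of a centred quadratic form -/

/-- Weights `b` of a Gaussian quadratic form, with total squared weight `1/2` and maximal weight at
most `β`, together with the noncentralities `d`. -/
structure IsWeightSystem (b d : ℕ → ℝ) (β : ℝ) : Prop where
  nonneg : ∀ j, 0 ≤ b j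
  le_bound : ∀ j, b j ≤ β
  nonneg_noncentrality : ∀ j, 0 ≤ d j
  summable : Summable b
  summable_noncentrality : Summable d
  hasSum_sq : HasSum (fun j => b j ^ 2) (1 / 2)

/-- Logarithm of the Laplace transform of `b (ξ² - 1) + 2 b τ ξ`, where `ξ` is standard normal and
`d = b τ²`. -/
noncomputable def cumulantTerm (b d : ℝ) (z : ℂ) : ℂ :=
  -(1 / 2) * Complex.log (1 - 2 * z * b) - z * b + 2 * z ^ 2 * b * d / (1 - 2 * z * b)

/-- Logarithm of the Laplace transform of a centred quadratic form. -/
noncomputable def cumulant (b d : ℕ → ℝ) (z : ℂ) : ℂ := ∑' j, cumulantTerm (b j) (d j) z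

/-- Only an upper bound on `Re z` matters: for `Re z ≤ 0` the real part is already at least one. -/
lemma half_le_re_one_sub {b β : ℝ} (hb : 0 ≤ b) (hbβ : b ≤ β) {z : ℂ} (hz : z.re * β ≤ 1 / 4) :
    1 / 2 ≤ (1 - 2 * z * b).re := by
  have h2 : z.re * b ≤ 1 / 4 := by
    rcases le_total 0 z.re with h | h
    · exact (mul_le_mul_of_nonneg_left hbβ h).trans hz
    · nlinarith
  have : (1 - 2 * z * b).re = 1 - 2 * (z.re * b) := by simp; ring
  rw [this]; linarith

lemma half_le_norm_one_sub {b β : ℝ} (hb : 0 ≤ b) (hbβ : b ≤ β) {z : ℂ}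
    (hz : z.re * β ≤ 1 / 4) : 1 / 2 ≤ ‖(1 - 2 * z * b : ℂ)‖ :=
  (half_le_re_one_sub hb hbβ hz).trans (Complex.re_le_norm _)

lemma norm_noncentral_term_le {b d β : ℝ} (hb : 0 ≤ b) (hbβ : b ≤ β) (hd : 0 ≤ d) {z : ℂ}
    (hz : z.re * β ≤ 1 / 4) :
    ‖2 * z ^ 2 * b * d / (1 - 2 * z * b)‖ ≤ 4 * ‖z‖ ^ 2 * β * d := by
  have h := half_le_norm_one_sub hb hbβ hz
  rw [norm_div, div_le_iff₀ (by linarith)]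
  simp only [norm_mul, norm_pow, Complex.norm_real, Real.norm_of_nonneg hb, Real.norm_of_nonneg hd,
    Complex.norm_ofNat]
  have h1 : 2 * ‖z‖ ^ 2 * b * d ≤ 2 * ‖z‖ ^ 2 * β * d := by gcongr
  have h2 : 0 ≤ 2 * ‖z‖ ^ 2 * β * d := by have := hb.trans hbβ; positivity
  nlinarith

lemma IsWeightSystem.bound_nonneg {b d : ℕ → ℝ} {β : ℝ} (h : IsWeightSystem b d β) : 0 ≤ β :=
  (h.nonneg 0).trans (h.le_bound 0)

lemma IsWeightSystem.summable_cumulantTerm {b d : ℕ → ℝ} {β : ℝ} (h : IsWeightSystem b d β)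
    {z : ℂ} (hz : z.re * β ≤ 1 / 4) : Summable fun j => cumulantTerm (b j) (d j) z := by
  have hb : Summable fun j => (b j : ℂ) := Complex.summable_ofReal.2 h.summable
  have h1 : Summable fun j => Complex.log (1 + -(2 * z * b j)) :=
    Complex.summable_log_one_add_of_summable ((hb.mul_left (2 * z)).neg)
  simp only [← sub_eq_add_neg] at h1
  refine ((h1.mul_left _).sub (hb.mul_left z)).add ?_
  exact Summable.of_norm_bounded (h.summable_noncentrality.mul_left (4 * ‖z‖ ^ 2 * β))
    fun j => norm_noncentral_term_le (h.nonneg j) (h.le_bound j) (h.nonneg_noncentrality j) hz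

/-- Second-order Taylor remainder of the logarithm at `-2w`, whose modulus is at most `1/2`; it
gives the constant `8/3`, rounded up to `4`. -/
lemma norm_half_log_sub_le {w : ℂ} (hw : ‖w‖ ≤ 1 / 4) :
    ‖-(1 / 2) * Complex.log (1 - 2 * w) - w - w ^ 2‖ ≤ 4 * ‖w‖ ^ 3 := by
  have h2 : ‖(-(2 * w) : ℂ)‖ = 2 * ‖w‖ := by simp
  have h := Complex.norm_log_sub_logTaylor_le 2 (z := -(2 * w)) (by rw [h2]; linarith)
  rw [h2] at h
  have heq : -(1 / 2) * Complex.log (1 - 2 * w) - w - w ^ 2 =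
      -(1 / 2) * (Complex.log (1 + -(2 * w)) - Complex.logTaylor (2 + 1) (-(2 * w))) := by
    rw [← sub_eq_add_neg]
    simp [Complex.logTaylor_succ, Complex.logTaylor_zero]
    ring
  rw [heq, norm_mul]
  have h3 : (1 - 2 * ‖w‖)⁻¹ ≤ 2 := by
    rw [inv_le_comm₀ (by linarith) (by norm_num)]; linarith
  have h4 : (2 * ‖w‖) ^ (2 + 1) * (1 - 2 * ‖w‖)⁻¹ / ((2 : ℕ) + 1) ≤
      (2 * ‖w‖) ^ (2 + 1) * 2 / ((2 : ℕ) + 1) := by gcongr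
  have h5 : ‖(-(1 / 2) : ℂ)‖ = 1 / 2 := by simp
  rw [h5]
  have h6 : (2 * ‖w‖) ^ (2 + 1) * 2 / ((2 : ℕ) + 1) = 16 / 3 * ‖w‖ ^ 3 := by push_cast; ring
  have : 0 ≤ ‖w‖ ^ 3 := by positivity
  linarith

lemma re_mul_le {z : ℂ} {β c : ℝ} (hβ : 0 ≤ β) (hz : ‖z‖ * β ≤ c) : z.re * β ≤ c :=
  (mul_le_mul_of_nonneg_right (Complex.re_le_norm z) hβ).trans hz

/-- The cumulant generating function is close to that of the standard normal law. -/
theorem IsWeightSystem.norm_cumulant_sub_le {b d : ℕ → ℝ} {β : ℝ} (h : IsWeightSystem b d β)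
    {z : ℂ} (hz : ‖z‖ * β ≤ 1 / 4) :
    ‖cumulant b d z - z ^ 2 / 2‖ ≤ β * (2 * ‖z‖ ^ 3 + 4 * ‖z‖ ^ 2 * ∑' j, d j) := by
  have hβ := h.bound_nonneg
  have hz' : z.re * β ≤ 1 / 4 := re_mul_le hβ hz
  -- Because `∑ b_j² = 1/2`, the quadratic Taylor terms sum exactly to `z²/2`, so the comparison can
  -- be made term by term.
  have hsq : HasSum (fun j => z ^ 2 * ((b j ^ 2 : ℝ) : ℂ)) (z ^ 2 * ((1 / 2 : ℝ) : ℂ)) :=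
    (Complex.hasSum_ofReal.2 h.hasSum_sq).mul_left _
  have hs := (h.summable_cumulantTerm hz').hasSum.sub hsq
  have hbound : HasSum (fun j => 4 * ‖z‖ ^ 3 * β * b j ^ 2 + 4 * ‖z‖ ^ 2 * β * d j)
      (4 * ‖z‖ ^ 3 * β * (1 / 2) + 4 * ‖z‖ ^ 2 * β * ∑' j, d j) :=
    (h.hasSum_sq.mul_left _).add (h.summable_noncentrality.hasSum.mul_left _)
  have hterm : ∀ j, ‖cumulantTerm (b j) (d j) z - z ^ 2 * ((b j ^ 2 : ℝ) : ℂ)‖ ≤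
      4 * ‖z‖ ^ 3 * β * b j ^ 2 + 4 * ‖z‖ ^ 2 * β * d j := by
    intro j
    have hb := h.nonneg j
    have hw : ‖z * b j‖ = ‖z‖ * b j := by
      rw [norm_mul, Complex.norm_real, Real.norm_of_nonneg hb]
    have hw4 : ‖z * b j‖ ≤ 1 / 4 := by
      rw [hw]
      exact (mul_le_mul_of_nonneg_left (h.le_bound j) (norm_nonneg _)).trans hz
    have h1 := norm_half_log_sub_le hw4
    rw [hw] at h1
    have h2 := norm_noncentral_term_le hb (h.le_bound j) (h.nonneg_noncentrality j) hz'
    have heq : cumulantTerm (b j) (d j) z - z ^ 2 * ((b j ^ 2 : ℝ) : ℂ) =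
        (-(1 / 2) * Complex.log (1 - 2 * (z * b j)) - z * b j - (z * b j) ^ 2) +
        2 * z ^ 2 * b j * d j / (1 - 2 * z * b j) := by
      rw [cumulantTerm, ← mul_assoc]; push_cast; ring
    rw [heq]
    refine (norm_add_le _ _).trans (add_le_add (h1.trans ?_) h2)
    -- One factor of the cubic remainder is spent on `β`; the remaining squares are summable with
    -- known sum.
    have : b j ^ 3 ≤ β * b j ^ 2 := by
      rw [pow_succ']
      exact mul_le_mul_of_nonneg_right (h.le_bound j) (sq_nonneg _)
    calc 4 * (‖z‖ * b j) ^ 3 = 4 * ‖z‖ ^ 3 * b j ^ 3 := by ring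
      _ ≤ 4 * ‖z‖ ^ 3 * (β * b j ^ 2) := by gcongr
      _ = _ := by ring
  have heq : cumulant b d z - z ^ 2 / 2 =
      ∑' j, (cumulantTerm (b j) (d j) z - z ^ 2 * ((b j ^ 2 : ℝ) : ℂ)) := by
    rw [hs.tsum_eq, cumulant]; push_cast; ring
  rw [heq]
  refine (tsum_of_norm_bounded hbound hterm).trans_eq ?_
  ring

/-- With denominators cleared, and up to the factor `2bd ≥ 0`, the difference of the two sides is
the square `u² (p + 2tb)²`, where `p = 1 - 2tb`. -/
lemma re_noncentral_term_le {b d t u : ℝ} (hb : 0 ≤ b) (hd : 0 ≤ d) (hp : 0 < 1 - 2 * t * b) :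
    (2 * (t + u * I) ^ 2 * b * d / (1 - 2 * (t + u * I) * b)).re ≤
      2 * t ^ 2 * b * d / (1 - 2 * t * b) := by
  set p := 1 - 2 * t * b with hpdef
  have hq : 0 < p ^ 2 + 4 * u ^ 2 * b ^ 2 := by positivity
  have hden : (1 - 2 * (t + u * I) * b : ℂ) = (p : ℂ) - (2 * u * b : ℝ) * I := by
    rw [hpdef]; push_cast; ring
  have hre : (2 * (t + u * I) ^ 2 * b * d / (1 - 2 * (t + u * I) * b)).re =
      2 * b * d * ((t ^ 2 - u ^ 2) * p - 4 * t * u ^ 2 * b) / (p ^ 2 + 4 * u ^ 2 * b ^ 2) := by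
    rw [hden, Complex.div_re]
    have hn : Complex.normSq ((p : ℂ) - (2 * u * b : ℝ) * I) = p ^ 2 + 4 * u ^ 2 * b ^ 2 := by
      rw [Complex.normSq_apply]; simp; ring
    rw [hn, ← add_div]
    congr 1
    simp [pow_two]
    ring
  rw [hre, div_le_div_iff₀ hq hp]
  have hbd : 0 ≤ 2 * b * d := by positivity
  have key : ((t ^ 2 - u ^ 2) * p - 4 * t * u ^ 2 * b) * p ≤
      t ^ 2 * (p ^ 2 + 4 * u ^ 2 * b ^ 2) := by
    have : t ^ 2 * (p ^ 2 + 4 * u ^ 2 * b ^ 2) - ((t ^ 2 - u ^ 2) * p - 4 * t * u ^ 2 * b) * p =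
        u ^ 2 * (p + 2 * t * b) ^ 2 := by ring
    have h2 : 0 ≤ u ^ 2 * (p + 2 * t * b) ^ 2 := by positivity
    linarith
  calc _ = 2 * b * d * (((t ^ 2 - u ^ 2) * p - 4 * t * u ^ 2 * b) * p) := by ring
    _ ≤ 2 * b * d * (t ^ 2 * (p ^ 2 + 4 * u ^ 2 * b ^ 2)) := mul_le_mul_of_nonneg_left key hbd
    _ = _ := by ring

/-- Bernoulli's inequality for an exponent in `[0, 1]`. -/
lemma log_one_add_mul_ge {s c : ℝ} (hs : 0 ≤ s) (hc : 0 ≤ c) (hc1 : c ≤ 1) :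
    c * Real.log (1 + s) ≤ Real.log (1 + c * s) := by
  have h := rpow_one_add_le_one_add_mul_self (s := s) (by linarith) hc hc1
  rw [← Real.log_rpow (by linarith)]
  exact Real.log_le_log (Real.rpow_pos_of_pos (by linarith) _) h

/-- Off the real axis `|1 - 2zb|² = p² + 4u²b² ≥ p² (1 + u²b²)`, as `p² ≤ 4`. Bernoulli with
exponent `16b² ≤ 1` turns the last factor into a power of `1 + u²/16`, a base free of `b`. The
exponents are proportional to `b²`, so summing over `j` gives a decay rate that depends on no
individual weight. -/
lemma re_cumulantTerm_le {b d β t u : ℝ} (hb : 0 ≤ b) (hbβ : b ≤ β) (hβ : β ≤ 1 / 4)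
    (hd : 0 ≤ d) (ht : |t| * β ≤ 1 / 4) :
    (cumulantTerm b d (t + u * I)).re ≤
      (cumulantTerm b d t).re - 4 * Real.log (1 + u ^ 2 / 16) * b ^ 2 := by
  have htb : |t| * b ≤ 1 / 4 := (mul_le_mul_of_nonneg_left hbβ (abs_nonneg _)).trans ht
  have htb' : |t * b| ≤ 1 / 4 := by rwa [abs_mul, abs_of_nonneg hb]
  obtain ⟨hl, hu⟩ := abs_le.1 htb'
  set p := 1 - 2 * t * b with hpdef
  have hp : 0 < p := by rw [hpdef]; linarith
  have hp2 : p ≤ 3 / 2 := by rw [hpdef]; linarith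
  have hn := re_noncentral_term_le (u := u) hb hd hp
  have hlog1 : (Complex.log (1 - 2 * (t + u * I) * b)).re =
      1 / 2 * Real.log (p ^ 2 + 4 * u ^ 2 * b ^ 2) := by
    rw [Complex.log_re, Complex.norm_def, Real.log_sqrt (Complex.normSq_nonneg _)]
    have : Complex.normSq (1 - 2 * (t + u * I) * b) = p ^ 2 + 4 * u ^ 2 * b ^ 2 := by
      rw [Complex.normSq_apply]; simp [hpdef]; ring
    rw [this]; ring
  have hlog2 : (Complex.log (1 - 2 * t * b)).re = 1 / 2 * Real.log (p ^ 2) := by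
    have : (1 - 2 * t * b : ℂ) = (p : ℂ) := by rw [hpdef]; push_cast; ring
    rw [this, Complex.log_ofReal_re, Real.log_pow]
    push_cast; ring
  have hre2 : (2 * (t : ℂ) ^ 2 * b * d / (1 - 2 * t * b)).re =
      2 * t ^ 2 * b * d / (1 - 2 * t * b) := by
    rw [← Complex.ofReal_re (2 * t ^ 2 * b * d / (1 - 2 * t * b))]
    push_cast
    rfl
  have hA : (cumulantTerm b d (t + u * I)).re = -(1 / 2) * (Complex.log (1 - 2 * (t + u * I) * b)).re
      - t * b + (2 * (t + u * I) ^ 2 * b * d / (1 - 2 * (t + u * I) * b)).re := by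
    have : (-(1 / 2) : ℂ) = ((-(1 / 2) : ℝ) : ℂ) := by push_cast; rfl
    rw [cumulantTerm, Complex.add_re, Complex.sub_re, this, Complex.re_ofReal_mul]
    simp
  have hB : (cumulantTerm b d t).re = -(1 / 2) * (Complex.log (1 - 2 * t * b)).re
      - t * b + (2 * (t : ℂ) ^ 2 * b * d / (1 - 2 * t * b)).re := by
    have : (-(1 / 2) : ℂ) = ((-(1 / 2) : ℝ) : ℂ) := by push_cast; rfl
    rw [cumulantTerm, Complex.add_re, Complex.sub_re, this, Complex.re_ofReal_mul]
    simp
  rw [hA, hB, hlog1, hlog2, hre2]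
  have hb16 : 16 * b ^ 2 ≤ 1 := by nlinarith
  have hc := log_one_add_mul_ge (s := u ^ 2 / 16) (c := 16 * b ^ 2) (by positivity)
    (by positivity) hb16
  have hmain : Real.log (p ^ 2) + Real.log (1 + 16 * b ^ 2 * (u ^ 2 / 16)) ≤
      Real.log (p ^ 2 + 4 * u ^ 2 * b ^ 2) := by
    rw [← Real.log_mul (by positivity) (by positivity)]
    refine Real.log_le_log (by positivity) ?_
    have h1 : p ^ 2 ≤ 4 := by nlinarith
    have h2 : 0 ≤ b ^ 2 * u ^ 2 := by positivity
    nlinarith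
  linarith

/-- The Laplace transform decays along vertical lines. -/
theorem IsWeightSystem.re_cumulant_le {b d : ℕ → ℝ} {β : ℝ} (h : IsWeightSystem b d β)
    (hβ : β ≤ 1 / 4) {t : ℝ} (ht : |t| * β ≤ 1 / 4) (u : ℝ) :
    (cumulant b d (t + u * I)).re ≤ (cumulant b d t).re - 2 * Real.log (1 + u ^ 2 / 16) := by
  have ht' : t * β ≤ 1 / 4 := (mul_le_mul_of_nonneg_right (le_abs_self t) h.bound_nonneg).trans ht
  have h1 := Complex.hasSum_re
    (h.summable_cumulantTerm (z := t + u * I) (by simpa using ht')).hasSum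
  have h2 := Complex.hasSum_re (h.summable_cumulantTerm (z := t) (by simpa using ht')).hasSum
  have h3 := h2.sub (h.hasSum_sq.mul_left (4 * Real.log (1 + u ^ 2 / 16)))
  refine (hasSum_le (fun j => re_cumulantTerm_le (h.nonneg j) (h.le_bound j) hβ
    (h.nonneg_noncentrality j) ht) h1 h3).trans_eq ?_
  rw [cumulant]; ring

end NeymanTest

namespace NeymanTest

open scoped Real
open Complex (I)

/-! ### Tail asymptotics of nearly Gaussian random variables -/

/-- A random variable whose cumulant generating function deviates from that of the standard normal
law by a third order term of size `β` and a second order term of size `β * B`. -/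
structure NearGaussian {Ω : Type*} [MeasurableSpace Ω] (P : Measure Ω) (X : Ω → ℝ) (β B : ℝ) :
    Prop where
  aemeasurable : AEMeasurable X P
  bound_nonneg : 0 ≤ β
  integrable_exp : ∀ t : ℝ, |t| * β ≤ 1 / 4 → Integrable (fun ω => Real.exp (t * X ω)) P
  exists_cumulant : ∃ K : ℂ → ℂ,
    (∀ z : ℂ, |z.re| * β ≤ 1 / 4 → complexMGF X P z = Complex.exp (K z)) ∧
    (∀ z : ℂ, ‖z‖ * β ≤ 1 / 4 → ‖K z - z ^ 2 / 2‖ ≤ β * (2 * ‖z‖ ^ 3 + 4 * ‖z‖ ^ 2 * B)) ∧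
    (β ≤ 1 / 4 → ∀ t u : ℝ, |t| * β ≤ 1 / 4 →
      (K (t + u * I)).re ≤ (K t).re - 2 * Real.log (1 + u ^ 2 / 16))

variable {Ω : Type*} [MeasurableSpace Ω] {P : Measure Ω}

lemma NearGaussian.mgf_eq_exp_cgf {X : Ω → ℝ} {β B : ℝ} (h : NearGaussian P X β B) {t : ℝ}
    (ht : |t| * β ≤ 1 / 4) :
    mgf X P t = Real.exp (cgf X P t) ∧
      |cgf X P t - t ^ 2 / 2| ≤ β * (2 * |t| ^ 3 + 4 * t ^ 2 * B) := by
  obtain ⟨K, hK, hK2, -⟩ := h.exists_cumulant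
  have h1 := hK t (by simpa using ht)
  have h2 : mgf X P t = Real.exp (K t).re := by
    have h3 := congrArg norm h1
    rw [complexMGF_ofReal, Complex.norm_real, Complex.norm_exp, Real.norm_of_nonneg mgf_nonneg] at h3
    exact h3
  have h4 : cgf X P t = (K t).re := by rw [cgf, h2, Real.log_exp]
  refine ⟨by rw [h4, h2], ?_⟩
  have h5 := (Complex.abs_re_le_norm _).trans (hK2 t (by simpa using ht))
  have h6 : (K t - (t : ℂ) ^ 2 / 2).re = (K t).re - t ^ 2 / 2 := by
    have : (t : ℂ) ^ 2 / 2 = ((t ^ 2 / 2 : ℝ) : ℂ) := by push_cast; rfl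
    rw [Complex.sub_re, this, Complex.ofReal_re]
  rw [h6] at h5
  rw [h4]
  simpa using h5

/-- Lower bound for a tail probability in terms of three values of the moment generating
function. -/
lemma mgf_sub_le_exp_mul_measureReal [IsFiniteMeasure P] {X : Ω → ℝ} (hX : AEMeasurable X P)
    {t s x z : ℝ} (ht : 0 ≤ t) (hs : 0 ≤ s) (h0 : Integrable (fun ω => Real.exp (t * X ω)) P)
    (h1 : Integrable (fun ω => Real.exp ((t - s) * X ω)) P)
    (h2 : Integrable (fun ω => Real.exp ((t + s) * X ω)) P) :
    mgf X P t - Real.exp (s * x) * mgf X P (t - s) - Real.exp (-(s * z)) * mgf X P (t + s) ≤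
      Real.exp (t * z) * P.real {ω | x < X ω} := by
  have hms : NullMeasurableSet {ω | x < X ω} P := nullMeasurableSet_lt aemeasurable_const hX
  have hi : Integrable (Set.indicator {ω | x < X ω} fun _ => Real.exp (t * z)) P :=
    (integrable_const _).indicator₀ hms
  -- For `X ≤ x` the factor `e^{s(x-X)}` is at least one, and for `X ≥ z` so is `e^{s(X-z)}`.
  -- Outside the window `(x, z)` the tilt `t` is therefore dominated by a neighbouring tilt.
  have hpt : ∀ ω, Real.exp (t * X ω) ≤ Set.indicator {ω | x < X ω} (fun _ => Real.exp (t * z)) ω +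
      Real.exp (s * x) * Real.exp ((t - s) * X ω) +
      Real.exp (-(s * z)) * Real.exp ((t + s) * X ω) := by
    intro ω
    rw [← Real.exp_add, ← Real.exp_add]
    have hi0 : 0 ≤ Set.indicator {ω | x < X ω} (fun _ => Real.exp (t * z)) ω :=
      Set.indicator_nonneg (fun _ _ => (Real.exp_pos _).le) _
    have he1 := Real.exp_pos (s * x + (t - s) * X ω)
    have he2 := Real.exp_pos (-(s * z) + (t + s) * X ω)
    by_cases hx : x < X ω
    · by_cases hz : X ω < z
      · rw [Set.indicator_of_mem (by exact hx)]
        have : Real.exp (t * X ω) ≤ Real.exp (t * z) := by gcongr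
        linarith
      · have : Real.exp (t * X ω) ≤ Real.exp (-(s * z) + (t + s) * X ω) := by
          rw [Real.exp_le_exp]
          nlinarith [not_lt.1 hz]
        linarith
    · have : Real.exp (t * X ω) ≤ Real.exp (s * x + (t - s) * X ω) := by
        rw [Real.exp_le_exp]
        nlinarith [not_lt.1 hx]
      linarith
  have hi1 : Integrable (fun ω => Set.indicator {ω | x < X ω} (fun _ => Real.exp (t * z)) ω +
      Real.exp (s * x) * Real.exp ((t - s) * X ω)) P := hi.add (h1.const_mul _)
  have h := integral_mono h0 (hi1.add (h2.const_mul _)) hpt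
  simp only [Pi.add_apply] at h
  rw [integral_add hi1 (h2.const_mul _), integral_add hi (h1.const_mul _),
    integral_const_mul, integral_const_mul, integral_indicator₀ hms, setIntegral_const,
    smul_eq_mul] at h
  simp only [mgf]
  linarith

section Family

variable {ι : Type*} {l : Filter ι} {X : ι → Ω → ℝ} {β B y : ι → ℝ}

lemma eventually_abs_mul_le {f : ι → ℝ} (h : Tendsto (fun i => β i * f i) l (𝓝 0)) (s : ℝ)
    (hf : ∀ᶠ i in l, 0 ≤ f i) : ∀ᶠ i in l, |s * f i| * β i ≤ 1 / 4 := by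
  have h1 := h.const_mul |s|
  rw [mul_zero] at h1
  filter_upwards [h1.eventually_le_const (show (0 : ℝ) < 1 / 4 by norm_num), hf] with i hi hfi
  rw [abs_mul, abs_of_nonneg hfi]
  linarith

/-- The cumulant generating function on the scale `y`. -/
lemma tendsto_cgf_div_sq (hX : ∀ᶠ i in l, NearGaussian P (X i) (β i) (B i))
    (hy : ∀ᶠ i in l, 0 < y i) (hβy : Tendsto (fun i => β i * y i) l (𝓝 0))
    (hβB : Tendsto (fun i => β i * B i) l (𝓝 0)) (s : ℝ) :
    Tendsto (fun i => cgf (X i) P (s * y i) / y i ^ 2) l (𝓝 (s ^ 2 / 2)) := by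
  rw [tendsto_iff_norm_sub_tendsto_zero]
  have hlim : Tendsto (fun i => 2 * |s| ^ 3 * (β i * y i) + 4 * s ^ 2 * (β i * B i)) l (𝓝 0) := by
    have := (hβy.const_mul (2 * |s| ^ 3)).add (hβB.const_mul (4 * s ^ 2))
    simpa using this
  refine squeeze_zero' (Eventually.of_forall fun _ => norm_nonneg _) ?_ hlim
  filter_upwards [hX, hy, eventually_abs_mul_le hβy s (hy.mono fun _ h => h.le)] with i hXi hyi hsi
  have h := (hXi.mgf_eq_exp_cgf hsi).2
  have heq : cgf (X i) P (s * y i) / y i ^ 2 - s ^ 2 / 2 =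
      (cgf (X i) P (s * y i) - (s * y i) ^ 2 / 2) / y i ^ 2 := by field_simp
  rw [heq, Real.norm_eq_abs, abs_div, abs_of_pos (by positivity : 0 < y i ^ 2),
    div_le_iff₀ (by positivity)]
  refine h.trans_eq ?_
  rw [abs_mul, abs_of_pos hyi]
  ring

variable [IsProbabilityMeasure P]

/-- A nearly Gaussian variable is positive with probability bounded away from zero. -/
theorem exists_pos_le_measureReal_pos (hX : ∀ᶠ i in l, NearGaussian P (X i) (β i) (B i))
    (hβ : Tendsto β l (𝓝 0)) (hβB : Tendsto (fun i => β i * B i) l (𝓝 0)) :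
    ∃ c > 0, ∀ᶠ i in l, c ≤ P.real {ω | 0 < X i ω} := by
  have hmgf : ∀ s : ℝ, Tendsto (fun i => mgf (X i) P s) l (𝓝 (Real.exp (s ^ 2 / 2))) := by
    intro s
    have h := tendsto_cgf_div_sq (y := fun _ => 1) hX (Eventually.of_forall fun _ => one_pos)
      (by simpa using! hβ) hβB s
    simp only [mul_one, one_pow, div_one] at h
    refine ((Real.continuous_exp.tendsto _).comp h).congr' ?_
    filter_upwards [hX, eventually_abs_mul_le (f := fun _ => 1) (by simpa using hβ) s
      (Eventually.of_forall fun _ => zero_le_one)] with i hXi hi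
    exact (hXi.mgf_eq_exp_cgf (by simpa using hi)).1.symm
  -- Tilt `t = 2`, step `s = 2`, window `(0, 4)`: the Gaussian limit `e² - 2` exceeds one, which
  -- leaves the lower bound `e^{-8} = e^{-tz}` for the probability.
  have hlim := ((hmgf 2).sub (hmgf 0)).sub ((hmgf 4).const_mul (Real.exp (-8)))
  have hval : Real.exp (2 ^ 2 / 2) - Real.exp (0 ^ 2 / 2) - Real.exp (-8) * Real.exp (4 ^ 2 / 2) =
      Real.exp 2 - 2 := by
    rw [← Real.exp_add]; norm_num; ring
  rw [hval] at hlim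
  have hpos : (1 : ℝ) < Real.exp 2 - 2 := by
    have h2 : Real.exp 2 = Real.exp 1 * Real.exp 1 := by rw [← Real.exp_add]; norm_num
    have := Real.exp_one_gt_d9
    nlinarith
  refine ⟨Real.exp (-8), Real.exp_pos _, ?_⟩
  have hev := fun s : ℝ => eventually_abs_mul_le (f := fun _ => 1) (by simpa using hβ) s
    (Eventually.of_forall fun _ => zero_le_one)
  filter_upwards [hX, hlim.eventually_const_lt hpos, hev 0, hev 2, hev 4] with i hXi hi h0 h2 h4
  simp only [mul_one] at h0 h2 h4
  have h := mgf_sub_le_exp_mul_measureReal (x := 0) (z := 4) (t := 2) (s := 2) hXi.aemeasurable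
    (by norm_num) (by norm_num) (hXi.integrable_exp _ h2)
    (by simp)
    (by norm_num; exact hXi.integrable_exp _ h4)
  norm_num at h hi
  rw [Real.exp_neg, inv_le_iff_one_le_mul₀ (Real.exp_pos _), mul_comm]
  linarith

/-- Logarithmic asymptotics of tail probabilities. -/
theorem tendsto_log_tail_div_sq (hX : ∀ᶠ i in l, NearGaussian P (X i) (β i) (B i))
    (hy : Tendsto y l atTop) (hβy : Tendsto (fun i => β i * y i) l (𝓝 0))
    (hβB : Tendsto (fun i => β i * B i) l (𝓝 0)) {p : ι → ℝ}
    (hp1 : ∀ᶠ i in l, P.real {ω | y i < X i ω} ≤ p i)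
    (hp2 : ∀ᶠ i in l, p i ≤ P.real {ω | y i ≤ X i ω}) :
    (∀ᶠ i in l, 0 < p i) ∧ Tendsto (fun i => Real.log (p i) / y i ^ 2) l (𝓝 (-(1 / 2))) := by
  have hy0 : ∀ᶠ i in l, 0 < y i := hy.eventually_gt_atTop 0
  have hy2 : Tendsto (fun i => y i ^ 2) l atTop := (tendsto_pow_atTop two_ne_zero).comp hy
  have hcgf := tendsto_cgf_div_sq hX hy0 hβy hβB
  have hev := fun s : ℝ => eventually_abs_mul_le hβy s (hy0.mono fun _ h => h.le)
  -- Tilting by `(1+η)y` concentrates the mass inside the window `(y, (1+2η)y)`; half of the tilted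
  -- mass is kept.
  have hlower : ∀ η : ℝ, 0 < η → ∀ᶠ i in l, Real.exp (-Real.log 2 + cgf (X i) P ((1 + η) * y i) -
      (1 + η) * (1 + 2 * η) * y i ^ 2) ≤ p i := by
    intro η hη
    -- `hA` and `hB` compare the two discarded sides with the tilted mass. Both limiting exponents
    -- equal `-η²/2`, so eventually each side is at most a quarter of it.
    have hA : Tendsto (fun i => y i ^ 2 * (η + cgf (X i) P (1 * y i) / y i ^ 2 -
        cgf (X i) P ((1 + η) * y i) / y i ^ 2)) l atBot := by
      refine hy2.atTop_mul_neg (C := η + 1 ^ 2 / 2 - (1 + η) ^ 2 / 2) (by nlinarith) ?_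
      exact ((hcgf 1).const_add η).sub (hcgf (1 + η))
    have hB : Tendsto (fun i => y i ^ 2 * (-(η * (1 + 2 * η)) +
        cgf (X i) P ((1 + 2 * η) * y i) / y i ^ 2 -
        cgf (X i) P ((1 + η) * y i) / y i ^ 2)) l atBot := by
      refine hy2.atTop_mul_neg
        (C := -(η * (1 + 2 * η)) + (1 + 2 * η) ^ 2 / 2 - (1 + η) ^ 2 / 2) (by nlinarith) ?_
      exact ((hcgf (1 + 2 * η)).const_add _).sub (hcgf (1 + η))
    filter_upwards [hX, hy0, hev 1, hev (1 + η), hev (1 + 2 * η), hp1,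
      hA.eventually_le_atBot (-Real.log 4), hB.eventually_le_atBot (-Real.log 4)]
      with i hXi hyi h1 h2 h3 hpi hAi hBi
    have e1 : (1 + η) * y i - η * y i = 1 * y i := by ring
    have e2 : (1 + η) * y i + η * y i = (1 + 2 * η) * y i := by ring
    have h := mgf_sub_le_exp_mul_measureReal (x := y i) (z := (1 + 2 * η) * y i)
      (t := (1 + η) * y i) (s := η * y i) hXi.aemeasurable (by positivity) (by positivity)
      (hXi.integrable_exp _ h2) (by rw [e1]; exact hXi.integrable_exp _ h1)
      (by rw [e2]; exact hXi.integrable_exp _ h3)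
    rw [e1, e2, (hXi.mgf_eq_exp_cgf h1).1, (hXi.mgf_eq_exp_cgf h2).1,
      (hXi.mgf_eq_exp_cgf h3).1, ← Real.exp_add, ← Real.exp_add] at h
    set a := cgf (X i) P (1 * y i)
    set b := cgf (X i) P ((1 + η) * y i)
    set c := cgf (X i) P ((1 + 2 * η) * y i)
    have hy2i : 0 < y i ^ 2 := by positivity
    have hAi' : η * y i * y i + a ≤ b + -Real.log 4 := by
      have : y i ^ 2 * (η + a / y i ^ 2 - b / y i ^ 2) = η * y i * y i + a - b := by field_simp
      linarith
    have hBi' : -(η * y i * ((1 + 2 * η) * y i)) + c ≤ b + -Real.log 4 := by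
      have : y i ^ 2 * (-(η * (1 + 2 * η)) + c / y i ^ 2 - b / y i ^ 2) =
          -(η * y i * ((1 + 2 * η) * y i)) + c - b := by field_simp
      linarith
    have hA2 := Real.exp_le_exp.2 hAi'
    have hB2 := Real.exp_le_exp.2 hBi'
    rw [Real.exp_add b, Real.exp_neg (Real.log 4), Real.exp_log (by norm_num)] at hA2 hB2
    have hfin : Real.exp b * 2⁻¹ ≤ Real.exp ((1 + η) * y i * ((1 + 2 * η) * y i)) * p i := by
      have := mul_le_mul_of_nonneg_left hpi
        (Real.exp_pos ((1 + η) * y i * ((1 + 2 * η) * y i))).le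
      linarith
    have hexp : Real.exp (-Real.log 2 + b - (1 + η) * (1 + 2 * η) * y i ^ 2) =
        Real.exp b * 2⁻¹ / Real.exp ((1 + η) * y i * ((1 + 2 * η) * y i)) := by
      rw [Real.exp_sub, Real.exp_add, Real.exp_neg, Real.exp_log (by norm_num)]
      congr 1
      · ring
      · congr 1; ring
    rw [hexp, div_le_iff₀ (Real.exp_pos _)]
    linarith
  have hpos : ∀ᶠ i in l, 0 < p i :=
    (hlower 1 one_pos).mono fun i h => (Real.exp_pos _).trans_le h
  refine ⟨hpos, tendsto_order.2 ⟨fun a ha => ?_, fun a ha => ?_⟩⟩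
  -- The rate obtained for fixed `η` tends to `1/2 - 1 = -1/2` as the window shrinks.
  · have hc : Tendsto (fun η : ℝ => (1 + η) ^ 2 / 2 - (1 + η) * (1 + 2 * η)) (𝓝[>] 0)
        (𝓝 (-(1 / 2))) := by
      have : Tendsto (fun η : ℝ => (1 + η) ^ 2 / 2 - (1 + η) * (1 + 2 * η)) (𝓝 0)
          (𝓝 ((1 + 0) ^ 2 / 2 - (1 + 0) * (1 + 2 * 0))) :=
        Continuous.tendsto (by fun_prop) 0
      refine (this.mono_left nhdsWithin_le_nhds).trans_eq ?_
      norm_num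
    obtain ⟨η, hηa, hη⟩ := ((hc.eventually_const_lt ha).and self_mem_nhdsWithin).exists
    have hlim : Tendsto (fun i => -Real.log 2 / y i ^ 2 + cgf (X i) P ((1 + η) * y i) / y i ^ 2 -
        (1 + η) * (1 + 2 * η)) l (𝓝 (0 + (1 + η) ^ 2 / 2 - (1 + η) * (1 + 2 * η))) :=
      ((tendsto_const_nhds.div_atTop hy2).add (hcgf (1 + η))).sub_const _
    rw [zero_add] at hlim
    filter_upwards [hlim.eventually_const_lt hηa, hlower η hη, hy0, hpos] with i h1 h2 hyi hpi
    refine h1.trans_le ?_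
    rw [le_div_iff₀ (by positivity)]
    have h3 := (Real.le_log_iff_exp_le hpi).2 h2
    refine le_trans (le_of_eq ?_) h3
    field_simp
  -- Chernoff's bound at the Gaussian optimum `t = y`.
  · have hlim : Tendsto (fun i => -1 + cgf (X i) P (1 * y i) / y i ^ 2) l
        (𝓝 (-1 + 1 ^ 2 / 2)) := (hcgf 1).const_add _
    filter_upwards [hlim.eventually_lt_const (show (-1 + 1 ^ 2 / 2 : ℝ) < a by linarith), hX,
      hev 1, hy0, hpos, hp2] with i h1 hXi hi hyi hpi hp2i
    refine lt_of_le_of_lt ?_ h1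
    have h := measure_ge_le_exp_cgf (X := X i) (μ := P) (y i) hyi.le
      (by simpa using hXi.integrable_exp _ hi)
    have h3 := Real.log_le_log hpi (hp2i.trans h)
    rw [Real.log_exp] at h3
    rw [div_le_iff₀ (by positivity), one_mul]
    refine h3.trans_eq ?_
    field_simp

/-- Logarithmic asymptotics in terms of normal quantiles. -/
theorem isEquivalent_sqrt_abs_log {p : ι → ℝ} (hy : Tendsto y l atTop)
    (h : Tendsto (fun i => Real.log (p i) / y i ^ 2) l (𝓝 (-(1 / 2)))) :
    (fun i => √(2 * |Real.log (p i)|)) ~[l] y := by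
  have hy0 : ∀ᶠ i in l, 0 < y i := hy.eventually_gt_atTop 0
  refine (isEquivalent_iff_tendsto_one (hy0.mono fun i h => h.ne')).2 ?_
  have h1 := ((Real.continuous_sqrt.tendsto _).comp ((h.abs).const_mul 2))
  have h2 : √(2 * |(-(1 / 2) : ℝ)|) = 1 := by norm_num
  rw [h2] at h1
  refine h1.congr' ?_
  filter_upwards [hy0] with i hyi
  simp only [Function.comp, Pi.div_apply]
  rw [abs_div, abs_of_pos (by positivity : 0 < y i ^ 2), ← mul_div_assoc,
    Real.sqrt_div' _ (by positivity), Real.sqrt_sq hyi.le]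

theorem tendsto_zero_of_tendsto_log_div_sq {p : ι → ℝ} (hy : Tendsto y l atTop)
    (hp : ∀ᶠ i in l, 0 < p i)
    (h : Tendsto (fun i => Real.log (p i) / y i ^ 2) l (𝓝 (-(1 / 2)))) : Tendsto p l (𝓝 0) := by
  have hy2 : Tendsto (fun i => y i ^ 2) l atTop := (tendsto_pow_atTop two_ne_zero).comp hy
  have h1 := Real.tendsto_exp_atBot.comp (hy2.atTop_mul_neg (by norm_num) h)
  refine h1.congr' ?_
  filter_upwards [hp, hy.eventually_gt_atTop 0] with i hpi hyi
  simp only [Function.comp]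
  rw [mul_div_cancel₀ _ (by positivity), Real.exp_log hpi]

end Family

end NeymanTest

namespace NeymanTest

open scoped Real
open Complex (I)

/-! ### Sharp tail asymptotics -/

/-- A Mills-type lower bound: on `(y, y + 1/y]` one has `v² ≤ y² + 3`, so the density loses at most
`e^{-3/2}` over an interval of length `1/y`. -/
lemma sq_mul_le_measureReal_gaussianReal {y : ℝ} (hy : 1 ≤ y) :
    (√(2 * π))⁻¹ * Real.exp (-(3 / 2)) ≤
      y * Real.exp (y ^ 2 / 2) * (gaussianReal 0 1).real {v | y < v} := by
  have hy0 : 0 < y := by linarith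
  have hinv : y⁻¹ ≤ 1 := inv_le_one_of_one_le₀ hy
  set c := (√(2 * π))⁻¹ * Real.exp (-(y ^ 2 / 2) - 3 / 2)
  have hreal : (gaussianReal 0 1).real {v | y < v} = ∫ v in Set.Ioi y, gaussianPDFReal 0 1 v := by
    rw [measureReal_def, gaussianReal_apply_eq_integral _ one_ne_zero, ENNReal.toReal_ofReal]
    · rfl
    · exact setIntegral_nonneg measurableSet_Ioi fun v _ => gaussianPDFReal_nonneg 0 1 v
  have hpdf : ∀ v ∈ Set.Ioc y (y + y⁻¹), c ≤ gaussianPDFReal 0 1 v := by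
    intro v hv
    rw [gaussianPDFReal]
    simp only [c, NNReal.coe_one, mul_one, sub_zero]
    gcongr
    have h1 : v ^ 2 ≤ (y + y⁻¹) ^ 2 := by
      have := hv.1; have := hv.2
      exact pow_le_pow_left₀ (by linarith) hv.2 2
    have h2 : (y + y⁻¹) ^ 2 = y ^ 2 + 2 + y⁻¹ ^ 2 := by field_simp; ring
    have h3 : y⁻¹ ^ 2 ≤ 1 := pow_le_one₀ (by positivity) hinv
    linarith
  have hle : y⁻¹ * c ≤ ∫ v in Set.Ioi y, gaussianPDFReal 0 1 v := by
    have h1 : ∫ v in Set.Ioc y (y + y⁻¹), c ≤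
        ∫ v in Set.Ioc y (y + y⁻¹), gaussianPDFReal 0 1 v :=
      setIntegral_mono_on (integrableOn_const (by simp))
        (integrable_gaussianPDFReal 0 1).integrableOn measurableSet_Ioc hpdf
    have h2 : ∫ v in Set.Ioc y (y + y⁻¹), gaussianPDFReal 0 1 v ≤
        ∫ v in Set.Ioi y, gaussianPDFReal 0 1 v :=
      setIntegral_mono_set (integrable_gaussianPDFReal 0 1).integrableOn
        (ae_of_all _ fun v => gaussianPDFReal_nonneg 0 1 v)
        (Set.Ioc_subset_Ioi_self).eventuallyLE
    refine le_trans (le_of_eq ?_) (h1.trans h2)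
    rw [setIntegral_const, smul_eq_mul, measureReal_def, Real.volume_Ioc,
      ENNReal.toReal_ofReal (by simp [hy0.le])]
    ring
  rw [hreal]
  calc (√(2 * π))⁻¹ * Real.exp (-(3 / 2)) = y * Real.exp (y ^ 2 / 2) * (y⁻¹ * c) := by
        simp only [c]
        rw [sub_eq_add_neg, Real.exp_add, Real.exp_neg (y ^ 2 / 2)]
        field_simp
    _ ≤ _ := by gcongr

lemma measureReal_gaussianReal_Ici (y : ℝ) :
    (gaussianReal 0 1).real {v | y ≤ v} = (gaussianReal 0 1).real {v | y < v} := by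
  have := nullSingletonClass_gaussianReal (μ := 0) (v := 1) one_ne_zero
  exact measureReal_congr Ioi_ae_eq_Ici.symm

lemma one_sub_Phi (y : ℝ) : 1 - Phi y = (gaussianReal 0 1).real {v | y < v} := by
  rw [Phi, cdf_eq_real, ← probReal_compl_eq_one_sub measurableSet_Iic, Set.compl_Iic]
  rfl

lemma Phi_neg (y : ℝ) : Phi (-y) = (gaussianReal 0 1).real {v | y ≤ v} := by
  have h : (gaussianReal 0 1).map (fun v => -v) = gaussianReal 0 1 := by
    simpa using gaussianReal_map_neg (μ := 0) (v := 1)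
  rw [Phi, cdf_eq_real]
  conv_lhs => rw [← h]
  rw [map_measureReal_apply measurable_neg measurableSet_Iic]
  congr 1
  ext v
  simp

lemma complexMGF_id_standard (z : ℂ) :
    complexMGF id (gaussianReal 0 1) z = Complex.exp (z ^ 2 / 2) := by
  rw [complexMGF_id_gaussianReal]
  simp

lemma integrable_exp_standard (t : ℝ) :
    Integrable (fun v => Real.exp (t * id v)) (gaussianReal 0 1) :=
  integrable_exp_mul_gaussianReal t

variable {Ω : Type*} [MeasurableSpace Ω] {P : Measure Ω}

/-- One integrable majorant for both transforms along a vertical line; `π > 3` leaves ample room. -/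
lemma inv_one_add_sq_bounds (w : ℝ) :
    Real.exp (-(2 * Real.log (1 + (2 * π * w) ^ 2 / 16))) ≤ (1 + w ^ 2)⁻¹ ∧
      Real.exp (-((2 * π * w) ^ 2 / 2)) ≤ (1 + w ^ 2)⁻¹ := by
  have hpi : 9 ≤ π ^ 2 := by nlinarith [Real.pi_gt_three]
  have h1 : w ^ 2 ≤ (2 * π * w) ^ 2 / 16 * 2 := by
    have : (2 * π * w) ^ 2 = 4 * π ^ 2 * w ^ 2 := by ring
    rw [this]; nlinarith [sq_nonneg w]
  have h0 : 0 ≤ (2 * π * w) ^ 2 / 16 := by positivity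
  constructor
  · rw [Real.exp_neg]
    refine inv_anti₀ (by positivity) ?_
    rw [two_mul, Real.exp_add, Real.exp_log (by positivity)]
    nlinarith
  · rw [Real.exp_neg]
    refine inv_anti₀ (by positivity) ?_
    have := Real.add_one_le_exp ((2 * π * w) ^ 2 / 2)
    nlinarith

lemma norm_exp_sq_half (y u : ℝ) :
    ‖Complex.exp ((y + (u : ℝ) * I) ^ 2 / 2)‖ = Real.exp (y ^ 2 / 2) * Real.exp (-(u ^ 2 / 2)) := by
  have : ((y + (u : ℝ) * I) ^ 2 / 2 : ℂ) = ((y ^ 2 / 2 + -(u ^ 2 / 2) : ℝ) : ℂ) + (y * u : ℝ) * I := by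
    push_cast
    linear_combination (u : ℂ) ^ 2 / 2 * Complex.I_sq
  rw [this, Complex.norm_exp, ← Real.exp_add, Complex.add_re, Complex.ofReal_re,
    Complex.re_ofReal_mul, Complex.I_re, mul_zero, add_zero]

lemma integrable_gaussian_line (y : ℝ) :
    Integrable fun w : ℝ => Complex.exp ((y + (2 * π * w : ℝ) * I) ^ 2 / 2) := by
  refine (integrable_inv_one_add_sq.const_mul (Real.exp (y ^ 2 / 2))).mono'
    (Measurable.aestronglyMeasurable (by fun_prop)) (ae_of_all _ fun w => ?_)
  rw [norm_exp_sq_half]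
  exact mul_le_mul_of_nonneg_left (inv_one_add_sq_bounds w).2 (Real.exp_pos _).le

lemma NearGaussian.norm_complexMGF_le [IsFiniteMeasure P] {X : Ω → ℝ} {β B : ℝ}
    (h : NearGaussian P X β B) (hβ : β ≤ 1 / 4) {t : ℝ} (ht : |t| * β ≤ 1 / 4) (w : ℝ) :
    ‖complexMGF X P (t + (2 * π * w : ℝ) * I)‖ ≤ mgf X P t * (1 + w ^ 2)⁻¹ := by
  obtain ⟨K, hK, -, hK3⟩ := h.exists_cumulant
  have h1 := congrArg norm (hK t (by simpa using ht))
  rw [complexMGF_ofReal, Complex.norm_real, Complex.norm_exp, Real.norm_of_nonneg mgf_nonneg] at h1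
  rw [h1, hK _ (by simpa using ht), Complex.norm_exp]
  refine (Real.exp_le_exp.2 (hK3 hβ t (2 * π * w) ht)).trans ?_
  rw [sub_eq_add_neg, Real.exp_add]
  exact mul_le_mul_of_nonneg_left (inv_one_add_sq_bounds w).1 (Real.exp_pos _).le

lemma NearGaussian.integrable_complexMGF [IsFiniteMeasure P] {X : Ω → ℝ} {β B : ℝ}
    (h : NearGaussian P X β B) (hβ : β ≤ 1 / 4) {t : ℝ} (ht : |t| * β ≤ 1 / 4) :
    Integrable fun w : ℝ => complexMGF X P (t + (2 * π * w : ℝ) * I) :=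
  (integrable_inv_one_add_sq.const_mul (mgf X P t)).mono'
    (aestronglyMeasurable_complexMGF h.aemeasurable t)
    (ae_of_all _ fun w => h.norm_complexMGF_le hβ ht w)

variable {ι : Type*} {l : Filter ι} [l.IsCountablyGenerated] {X : ι → Ω → ℝ} {β B y : ι → ℝ}
  [IsProbabilityMeasure P]

/-- Dominated convergence on the moving line `Re z = y`. For fixed frequency the transforms have
ratio `exp(K(z) - z²/2) → 1`; the vertical decay supplies the majorant. -/
lemma tendsto_integral_norm_complexMGF_sub (hX : ∀ᶠ i in l, NearGaussian P (X i) (β i) (B i))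
    (hy : Tendsto y l atTop) (hβy : Tendsto (fun i => β i * y i ^ 3) l (𝓝 0))
    (hB : ∀ᶠ i in l, 0 ≤ B i)
    (hβB : Tendsto (fun i => β i * y i ^ 2 * B i) l (𝓝 0)) :
    Tendsto (fun i => ∫ w : ℝ, Real.exp (-(y i ^ 2 / 2)) *
      ‖complexMGF (X i) P (y i + (2 * π * w : ℝ) * I) -
        complexMGF id (gaussianReal 0 1) (y i + (2 * π * w : ℝ) * I)‖) l (𝓝 0) := by
  have hy1 : ∀ᶠ i in l, 1 ≤ y i := hy.eventually_ge_atTop 1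
  have hβ0 : ∀ᶠ i in l, 0 ≤ β i := hX.mono fun i h => h.bound_nonneg
  have hβ1 : Tendsto (fun i => β i * y i) l (𝓝 0) := by
    refine squeeze_zero' ?_ ?_ hβy
    · filter_upwards [hβ0, hy1] with i h1 h2 using by positivity
    · filter_upwards [hβ0, hy1] with i h1 h2
      exact mul_le_mul_of_nonneg_left (le_self_pow₀ h2 (by norm_num)) h1
  have hβlim : Tendsto β l (𝓝 0) := by
    refine squeeze_zero' hβ0 ?_ hβ1
    filter_upwards [hβ0, hy1] with i h1 h2 using le_mul_of_one_le_right h1 h2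
  have hβ4 : ∀ᶠ i in l, β i ≤ 1 / 4 := hβlim.eventually_le_const (by norm_num)
  have hty := eventually_abs_mul_le hβ1 1 (hy1.mono fun i h => zero_le_one.trans h)
  simp only [one_mul] at hty
  have hdom : Tendsto (fun i => β i * (2 * |y i| ^ 3 + 4 * y i ^ 2 * B i)) l (𝓝 0) := by
    have := (hβy.const_mul 2).add (hβB.const_mul 4)
    rw [mul_zero, mul_zero, add_zero] at this
    refine this.congr' ?_
    filter_upwards [hy1] with i hi
    rw [abs_of_pos (by linarith)]
    ring
  rw [show 𝓝 (0 : ℝ) = 𝓝 (∫ _w : ℝ, 0) by simp]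
  -- The constant is `3 + 1`: eventually the transform at `y` is at most `e^{y²/2 + 1} ≤ 3
  -- e^{y²/2}`, and the Gaussian one contributes `e^{y²/2}`.
  refine tendsto_integral_filter_of_dominated_convergence (fun w => 4 * (1 + w ^ 2)⁻¹) ?_ ?_
    (integrable_inv_one_add_sq.const_mul 4) ?_
  · filter_upwards [hX] with i hi
    refine (((aestronglyMeasurable_complexMGF hi.aemeasurable _).sub ?_).norm).const_mul _
    exact aestronglyMeasurable_complexMGF aemeasurable_id _
  · filter_upwards [hX, hβ4, hty, hdom.eventually_le_const one_pos] with i hi h4 ht h1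
    refine ae_of_all _ fun w => ?_
    rw [complexMGF_id_standard, norm_mul, norm_norm, Real.norm_of_nonneg (Real.exp_pos _).le]
    have hM := hi.norm_complexMGF_le h4 ht w
    obtain ⟨hmgf, hcgf⟩ := hi.mgf_eq_exp_cgf ht
    have hc : cgf (X i) P (y i) ≤ y i ^ 2 / 2 + 1 := by
      have := (abs_le.1 (hcgf.trans h1)).2; linarith
    have hm3 : mgf (X i) P (y i) ≤ Real.exp (y i ^ 2 / 2) * 3 := by
      rw [hmgf]
      refine (Real.exp_le_exp.2 hc).trans ?_
      rw [Real.exp_add]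
      have := Real.exp_one_lt_d9
      exact mul_le_mul_of_nonneg_left (by linarith) (Real.exp_pos _).le
    have hw : 0 < (1 + w ^ 2)⁻¹ := by positivity
    have hG := norm_exp_sq_half (y i) (2 * π * w)
    have hG2 := (inv_one_add_sq_bounds w).2
    have he := Real.exp_pos (y i ^ 2 / 2)
    rw [Real.exp_neg, inv_mul_le_iff₀ he]
    refine (norm_sub_le _ _).trans ?_
    rw [hG]
    have h1 := mul_le_mul_of_nonneg_right hm3 hw.le
    have h2 := mul_le_mul_of_nonneg_left hG2 he.le
    linarith
  · refine ae_of_all _ fun w => ?_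
    set u : ℝ := 2 * π * w
    -- For a fixed frequency `|z|` is of order `y`, so the cumulant error is controlled by `β y³`
    -- and `β y² B`.
    have hnorm : ∀ᶠ i in l, ‖(y i + (u : ℝ) * I : ℂ)‖ ≤ (1 + |u|) * y i := by
      filter_upwards [hy1] with i hi
      refine (norm_add_le _ _).trans ?_
      simp only [norm_mul, Complex.norm_real, Complex.norm_I, mul_one, Real.norm_eq_abs]
      rw [abs_of_pos (by linarith)]
      nlinarith [abs_nonneg u]
    have hz4 : ∀ᶠ i in l, ‖(y i + (u : ℝ) * I : ℂ)‖ * β i ≤ 1 / 4 := by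
      filter_upwards [hnorm, hβ0, hy1,
        eventually_abs_mul_le hβ1 (1 + |u|) (hy1.mono fun i h => zero_le_one.trans h)]
        with i h1 h2 h3 h4
      refine (mul_le_mul_of_nonneg_right (h1.trans (le_abs_self _)) h2).trans h4
    have hlim : Tendsto (fun i => 2 * (1 + |u|) ^ 3 * (β i * y i ^ 3) +
        4 * (1 + |u|) ^ 2 * (β i * y i ^ 2 * B i)) l (𝓝 0) := by
      simpa using (hβy.const_mul (2 * (1 + |u|) ^ 3)).add (hβB.const_mul (4 * (1 + |u|) ^ 2))
    refine squeeze_zero' (g := fun i => 2 * (2 * (1 + |u|) ^ 3 * (β i * y i ^ 3) +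
        4 * (1 + |u|) ^ 2 * (β i * y i ^ 2 * B i)))
      (Eventually.of_forall fun i => by positivity) ?_ (by simpa using hlim.const_mul 2)
    filter_upwards [hX, hβ0, hB, hnorm, hz4, hty, hlim.eventually_le_const one_pos]
      with i hi h0 hBi hn hz ht h1
    obtain ⟨K, hK, hK2, -⟩ := hi.exists_cumulant
    set z : ℂ := y i + (u : ℝ) * I
    have hr : ‖K z - z ^ 2 / 2‖ ≤ 2 * (1 + |u|) ^ 3 * (β i * y i ^ 3) +
        4 * (1 + |u|) ^ 2 * (β i * y i ^ 2 * B i) := by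
      refine (hK2 z hz).trans ?_
      calc β i * (2 * ‖z‖ ^ 3 + 4 * ‖z‖ ^ 2 * B i) ≤
          β i * (2 * ((1 + |u|) * y i) ^ 3 + 4 * ((1 + |u|) * y i) ^ 2 * B i) := by gcongr
        _ = _ := by ring
    have hfac : complexMGF (X i) P z - complexMGF id (gaussianReal 0 1) z =
        Complex.exp (z ^ 2 / 2) * (Complex.exp (K z - z ^ 2 / 2) - 1) := by
      rw [hK z (by simpa [z] using ht), complexMGF_id_standard, mul_sub, ← Complex.exp_add]
      ring_nf
    rw [hfac, norm_mul, norm_exp_sq_half, ← mul_assoc, ← mul_assoc, ← Real.exp_add,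
      neg_add_cancel, Real.exp_zero, one_mul]
    have h2 := Complex.norm_exp_sub_one_le (hr.trans h1)
    have h3 : Real.exp (-(u ^ 2 / 2)) ≤ 1 := Real.exp_le_one_iff.2 (by linarith [sq_nonneg u])
    calc Real.exp (-(u ^ 2 / 2)) * ‖Complex.exp (K z - z ^ 2 / 2) - 1‖ ≤
        1 * (2 * ‖K z - z ^ 2 / 2‖) := by gcongr
      _ ≤ _ := by linarith

/-- Sharp asymptotics of tail probabilities in the moderate deviation zone. -/
theorem isEquivalent_tail (hX : ∀ᶠ i in l, NearGaussian P (X i) (β i) (B i))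
    (hy : Tendsto y l atTop) (hβy : Tendsto (fun i => β i * y i ^ 3) l (𝓝 0))
    (hB : ∀ᶠ i in l, 0 ≤ B i)
    (hβB : Tendsto (fun i => β i * y i ^ 2 * B i) l (𝓝 0)) {p : ι → ℝ}
    (hp : ∀ᶠ i in l, p i = P.real {ω | y i < X i ω} ∨ p i = P.real {ω | y i ≤ X i ω}) :
    p ~[l] fun i => (gaussianReal 0 1).real {v | y i < v} := by
  have hlim := tendsto_integral_norm_complexMGF_sub hX hy hβy hB hβB
  have hy1 : ∀ᶠ i in l, 1 ≤ y i := hy.eventually_ge_atTop 1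
  have hβ0 : ∀ᶠ i in l, 0 ≤ β i := hX.mono fun i h => h.bound_nonneg
  have hβ1 : Tendsto (fun i => β i * y i) l (𝓝 0) := by
    refine squeeze_zero' ?_ ?_ hβy
    · filter_upwards [hβ0, hy1] with i h1 h2 using by positivity
    · filter_upwards [hβ0, hy1] with i h1 h2
      exact mul_le_mul_of_nonneg_left (le_self_pow₀ h2 (by norm_num)) h1
  have hty := eventually_abs_mul_le hβ1 1 (hy1.mono fun i h => zero_le_one.trans h)
  simp only [one_mul] at hty
  have hβ4 : ∀ᶠ i in l, β i ≤ 1 / 4 := by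
    filter_upwards [hty, hy1, hβ0] with i h1 h2 h3
    refine le_trans ?_ h1
    exact le_mul_of_one_le_left h3 (h2.trans (le_abs_self _))
  set c := (√(2 * π))⁻¹ * Real.exp (-(3 / 2)) with hc
  have hcpos : 0 < c := by positivity
  refine isLittleO_iff.2 fun a ha => ?_
  filter_upwards [hX, hy1, hty, hβ4, hp, hlim.eventually_le_const (mul_pos ha hcpos)]
    with i hi h1 ht h4 hpi hle
  have hint := hi.integrable_exp _ ht
  have hdiff : Integrable fun w : ℝ => complexMGF (X i) P (y i + (2 * π * w : ℝ) * I) -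
      complexMGF id (gaussianReal 0 1) (y i + (2 * π * w : ℝ) * I) := by
    refine (hi.integrable_complexMGF h4 ht).sub ?_
    simp only [complexMGF_id_standard]
    exact integrable_gaussian_line _
  have hcmp : y i * Real.exp (y i * y i) * |p i - (gaussianReal 0 1).real {v | y i < v}| ≤
      ∫ w : ℝ, ‖complexMGF (X i) P (y i + (2 * π * w : ℝ) * I) -
        complexMGF id (gaussianReal 0 1) (y i + (2 * π * w : ℝ) * I)‖ := by
    rcases hpi with hpi | hpi
    · rw [hpi]
      exact abs_sub_measureReal_lt_le hi.aemeasurable aemeasurable_id (by linarith) (y i) hint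
        (integrable_exp_standard _) hdiff
    · rw [hpi, ← measureReal_gaussianReal_Ici]
      exact abs_sub_measureReal_le_le hi.aemeasurable aemeasurable_id (by linarith) (y i) hint
        (integrable_exp_standard _) hdiff
  rw [integral_const_mul, Real.exp_neg, inv_mul_le_iff₀ (Real.exp_pos _)] at hle
  have hq := sq_mul_le_measureReal_gaussianReal h1
  rw [← hc] at hq
  set q := (gaussianReal 0 1).real {v | y i < v}
  have hq0 : 0 ≤ q := measureReal_nonneg
  simp only [Pi.sub_apply]
  rw [Real.norm_eq_abs, Real.norm_of_nonneg hq0]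
  -- One factor cancels the normalization of the integral; the other, with `y`, is absorbed by the
  -- lower bound `c ≤ y E q` on the normal tail, which makes the error relative.
  have hexp : Real.exp (y i * y i) = Real.exp (y i ^ 2 / 2) * Real.exp (y i ^ 2 / 2) := by
    rw [← Real.exp_add]; ring_nf
  set E := Real.exp (y i ^ 2 / 2)
  have hE : 0 < E := Real.exp_pos _
  have hyE : 0 < y i * E := by have : 0 < y i := by linarith
                               positivity
  have h5 : y i * (E * E) * |p i - q| ≤ E * (a * (y i * E * q)) := by
    rw [hexp] at hcmp
    refine (hcmp.trans hle).trans ?_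
    gcongr
  have h6 : (y i * E * E) * |p i - q| ≤ (y i * E * E) * (a * q) := by linarith
  exact le_of_mul_le_mul_left h6 (by positivity)

end NeymanTest

namespace NeymanTest

open scoped Real
open Complex (I)

/-! ### Gaussian quadratic forms -/

/-- Logarithm of the Laplace transform of `b (ξ + τ)²`, where `ξ` is standard normal and
`d = b τ²`. -/
noncomputable def squareTerm (b d : ℝ) (z : ℂ) : ℂ :=
  -(1 / 2) * Complex.log (1 - 2 * z * b) + z * d / (1 - 2 * z * b)

/-- The added part `z (b + d)` is the contribution of the mean of `b (ξ + τ)²`. -/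
lemma squareTerm_eq {b d : ℝ} {z : ℂ} (h : (1 - 2 * z * b : ℂ) ≠ 0) :
    squareTerm b d z = cumulantTerm b d z + (z * b + z * d) := by
  rw [squareTerm, cumulantTerm]
  have : z * d / (1 - 2 * z * b) = 2 * z ^ 2 * b * d / (1 - 2 * z * b) + z * d := by
    rw [div_eq_iff h, add_mul, div_mul_cancel₀ _ h]
    ring
  rw [this]; ring

variable {Ω : Type*} [MeasurableSpace Ω] {P : Measure Ω}

lemma aemeasurable_of_map_eq_gaussianReal {X : Ω → ℝ} (h : P.map X = gaussianReal 0 1) :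
    AEMeasurable X P :=
  AEMeasurable.of_map_ne_zero (by rw [h]; exact IsProbabilityMeasure.ne_zero _)

/-- Laplace transform of a noncentral square of a standard normal variable. -/
lemma integral_cexp_mul_sq {X : Ω → ℝ} (hX : P.map X = gaussianReal 0 1) (b τ : ℝ) {z : ℂ}
    (hz : 0 < (1 - 2 * z * b).re) :
    ∫ ω, Complex.exp (z * (b * (X ω + τ) ^ 2 : ℝ)) ∂P =
      Complex.exp (squareTerm b (b * τ ^ 2) z) := by
  have hm := aemeasurable_of_map_eq_gaussianReal hX
  set s : ℂ := 1 - 2 * z * b with hs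
  have hs0 : s ≠ 0 := fun h => by rw [h] at hz; simp at hz
  have h1 : ∫ ω, Complex.exp (z * (b * (X ω + τ) ^ 2 : ℝ)) ∂P =
      ∫ v, Complex.exp (z * (b * (v + τ) ^ 2 : ℝ)) ∂(gaussianReal 0 1) := by
    rw [← hX, integral_map hm]
    exact Measurable.aestronglyMeasurable (by fun_prop)
  rw [h1, integral_gaussianReal_eq_integral_smul one_ne_zero]
  have h2 : ∀ v : ℝ, gaussianPDFReal 0 1 v • Complex.exp (z * (b * (v + τ) ^ 2 : ℝ)) =
      ((√(2 * π))⁻¹ : ℝ) * Complex.exp (-(s / 2) * v ^ 2 + (2 * z * b * τ) * v + z * b * τ ^ 2) := by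
    intro v
    rw [gaussianPDFReal, Complex.real_smul, Complex.ofReal_mul, Complex.ofReal_exp, mul_assoc,
      ← Complex.exp_add, hs]
    simp only [NNReal.coe_one, mul_one, sub_zero]
    congr 2
    push_cast
    ring
  simp_rw [h2]
  have hre : (-(s / 2)).re < 0 := by
    rw [Complex.neg_re, Complex.div_ofNat_re]; linarith
  rw [integral_const_mul, integral_cexp_quadratic hre]
  have hlog : ((π : ℂ) / -(-(s / 2))) ^ (1 / 2 : ℂ) =
      (√(2 * π) : ℝ) * Complex.exp (-(1 / 2) * Complex.log s) := by
    have hpi : (0 : ℝ) < 2 * π := by positivity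
    have hdiv : (π : ℂ) / -(-(s / 2)) = ((2 * π : ℝ) : ℂ) * s⁻¹ := by
      push_cast; field_simp
    -- `Re s > 0` keeps `s` off the branch cut, so the principal logarithm of `s⁻¹` is `-log s`.
    have harg : s.arg ≠ π := by
      intro h
      exact absurd (Complex.arg_eq_pi_iff.1 h).1 (by linarith)
    rw [hdiv, Complex.cpow_def_of_ne_zero (mul_ne_zero (by exact_mod_cast hpi.ne')
      (inv_ne_zero hs0)), Complex.log_ofReal_mul hpi (inv_ne_zero hs0), Complex.log_inv _ harg,
      Real.sqrt_eq_rpow, Real.rpow_def_of_pos hpi, Complex.ofReal_exp, ← Complex.exp_add]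
    congr 1
    push_cast
    ring
  have hc : ((√(2 * π))⁻¹ : ℝ) * ((√(2 * π) : ℝ) : ℂ) = 1 := by
    rw [← Complex.ofReal_mul, inv_mul_cancel₀ (by positivity), Complex.ofReal_one]
  rw [hlog, ← mul_assoc, ← mul_assoc, hc, one_mul, ← Complex.exp_add, squareTerm, ← hs]
  congr 2
  have : (2 * z * b * τ) ^ 2 / (4 * -(s / 2)) = -(2 * z ^ 2 * b ^ 2 * τ ^ 2 / s) := by
    field_simp
    ring
  rw [this]
  push_cast
  field_simp
  rw [hs]
  ring

/-! ### Laplace transforms of finite and infinite quadratic forms. -/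

/-- Partial sums of a Gaussian quadratic form. -/
noncomputable def partialForm (b τ : ℕ → ℝ) (ξ : ℕ → Ω → ℝ) (N : ℕ) (ω : Ω) : ℝ :=
  ∑ j ∈ Finset.range N, b j * (ξ j ω + τ j) ^ 2

/-- A noncentral Gaussian quadratic form. -/
noncomputable def quadForm (b τ : ℕ → ℝ) (ξ : ℕ → Ω → ℝ) (ω : Ω) : ℝ :=
  ∑' j, b j * (ξ j ω + τ j) ^ 2

variable {b τ : ℕ → ℝ} {ξ : ℕ → Ω → ℝ} {β : ℝ}

lemma complexMGF_partialForm (hξ : ∀ j, P.map (ξ j) = gaussianReal 0 1) (hind : iIndepFun ξ P)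
    (hb : ∀ j, 0 ≤ b j) (hβ : ∀ j, b j ≤ β) {z : ℂ} (hz : z.re * β ≤ 1 / 4) (N : ℕ) :
    complexMGF (partialForm b τ ξ N) P z =
      Complex.exp (∑ j ∈ Finset.range N, squareTerm (b j) (b j * τ j ^ 2) z) := by
  have hind' : iIndepFun (fun i : Fin N => ξ i) P := hind.precomp Fin.val_injective
  have h := hind'.integral_fun_prod_comp (𝕜 := ℂ) (X := fun i : Fin N => ξ i)
    (f := fun i v => Complex.exp (z * (b i * (v + τ i) ^ 2 : ℝ)))
    (fun i => aemeasurable_of_map_eq_gaussianReal (hξ i))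
    (fun i => Measurable.aestronglyMeasurable (by fun_prop))
  rw [Complex.exp_sum, Finset.prod_range]
  refine Eq.trans ?_ (h.trans (Finset.prod_congr rfl fun i _ => ?_))
  · rw [complexMGF]
    refine integral_congr_ae (ae_of_all _ fun ω => ?_)
    simp only [partialForm]
    rw [← Complex.exp_sum, Finset.sum_range, Complex.ofReal_sum, Finset.mul_sum]
  · refine integral_cexp_mul_sq (hξ i) _ _ ?_
    have := half_le_re_one_sub (hb i) (hβ i) hz
    linarith

lemma aemeasurable_partialForm (hξ : ∀ j, P.map (ξ j) = gaussianReal 0 1) (N : ℕ) :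
    AEMeasurable (partialForm b τ ξ N) P := by
  have := fun j => aemeasurable_of_map_eq_gaussianReal (hξ j)
  unfold partialForm
  fun_prop

/-- The Bochner integral of a nonintegrable function is zero by default, whereas the transform
formula, proved without integrability, gives a nonzero exponential. -/
lemma integrable_exp_partialForm (hξ : ∀ j, P.map (ξ j) = gaussianReal 0 1)
    (hind : iIndepFun ξ P) (hb : ∀ j, 0 ≤ b j) (hβ : ∀ j, b j ≤ β) {t : ℝ}
    (ht : t * β ≤ 1 / 4) (N : ℕ) :
    Integrable (fun ω => Real.exp (t * partialForm b τ ξ N ω)) P := by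
  by_contra hcon
  have h := complexMGF_partialForm (τ := τ) hξ hind hb hβ (z := t) (by simpa using ht) N
  rw [complexMGF_ofReal, mgf, integral_undef hcon] at h
  exact Complex.exp_ne_zero _ h.symm

/-- By Tonelli it suffices that the expectations are summable, and they are at most `2b_j + 2b_j
τ_j²`. -/
lemma ae_summable_quadForm [IsProbabilityMeasure P] (hξ : ∀ j, P.map (ξ j) = gaussianReal 0 1)
    (h : IsWeightSystem b (fun j => b j * τ j ^ 2) β) :
    ∀ᵐ ω ∂P, Summable fun j => b j * (ξ j ω + τ j) ^ 2 := by
  have hm := fun j => aemeasurable_of_map_eq_gaussianReal (hξ j)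
  have hvar : ∀ j, ∫⁻ ω, ENNReal.ofReal (ξ j ω ^ 2) ∂P = 1 := by
    intro j
    have h1 : ∫⁻ ω, ENNReal.ofReal (ξ j ω ^ 2) ∂P =
        ∫⁻ v, ENNReal.ofReal (v ^ 2) ∂(gaussianReal 0 1) := by
      rw [← hξ j, lintegral_map' (by fun_prop) (hm j)]
    have h2 : ∫ v, v ^ 2 ∂(gaussianReal 0 1) = 1 := by
      have := variance_id_gaussianReal (μ := 0) (v := 1)
      rw [variance_of_integral_eq_zero aemeasurable_id (by simp)] at this
      simpa using this
    have h3 : Integrable (fun v : ℝ => v ^ 2) (gaussianReal 0 1) := by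
      by_contra hcon
      rw [integral_undef hcon] at h2
      exact zero_ne_one h2
    rw [h1, ← ofReal_integral_eq_lintegral_ofReal h3 (ae_of_all _ fun v => sq_nonneg v), h2,
      ENNReal.ofReal_one]
  have hbound : ∀ j, ∫⁻ ω, ENNReal.ofReal (b j * (ξ j ω + τ j) ^ 2) ∂P ≤
      ENNReal.ofReal (2 * b j + 2 * (b j * τ j ^ 2)) := by
    intro j
    have hb := h.nonneg j
    have hd := h.nonneg_noncentrality j
    calc ∫⁻ ω, ENNReal.ofReal (b j * (ξ j ω + τ j) ^ 2) ∂P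
        ≤ ∫⁻ ω, (ENNReal.ofReal (2 * b j) * ENNReal.ofReal (ξ j ω ^ 2) +
          ENNReal.ofReal (2 * (b j * τ j ^ 2))) ∂P := by
          refine lintegral_mono fun ω => ?_
          rw [← ENNReal.ofReal_mul (by positivity), ← ENNReal.ofReal_add (by positivity)
            (by positivity)]
          refine ENNReal.ofReal_le_ofReal ?_
          nlinarith [mul_nonneg hb (sq_nonneg (ξ j ω - τ j))]
      _ = _ := by
          rw [lintegral_add_right _ measurable_const, lintegral_const_mul'' _
            (by have := hm j; fun_prop), hvar, lintegral_const, measure_univ, mul_one, mul_one,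
            ← ENNReal.ofReal_add (by positivity) (by positivity)]
  have hfin : ∫⁻ ω, ∑' j, ENNReal.ofReal (b j * (ξ j ω + τ j) ^ 2) ∂P ≠ ⊤ := by
    rw [lintegral_tsum fun j => by have := hm j; fun_prop]
    refine ne_top_of_le_ne_top ?_ (ENNReal.tsum_le_tsum hbound)
    have hs : Summable fun j => 2 * b j + 2 * (b j * τ j ^ 2) :=
      (h.summable.mul_left 2).add (h.summable_noncentrality.mul_left 2)
    rw [← ENNReal.ofReal_tsum_of_nonneg (fun j => ?_) hs]
    · exact ENNReal.ofReal_ne_top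
    · have := h.nonneg j
      positivity
  have hmeas : AEMeasurable (fun ω => ∑' j, ENNReal.ofReal (b j * (ξ j ω + τ j) ^ 2)) P :=
    AEMeasurable.tsum fun j => by have := hm j; fun_prop
  filter_upwards [ae_lt_top' hmeas hfin] with ω hω
  have h1 := ENNReal.summable_toReal hω.ne
  refine h1.congr fun j => ?_
  rw [ENNReal.toReal_ofReal (mul_nonneg (h.nonneg j) (sq_nonneg _))]

lemma ae_tendsto_partialForm [IsProbabilityMeasure P] (hξ : ∀ j, P.map (ξ j) = gaussianReal 0 1)
    (h : IsWeightSystem b (fun j => b j * τ j ^ 2) β) :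
    ∀ᵐ ω ∂P, Tendsto (fun N => partialForm b τ ξ N ω) atTop (𝓝 (quadForm b τ ξ ω)) ∧
      ∀ N, 0 ≤ partialForm b τ ξ N ω ∧ partialForm b τ ξ N ω ≤ quadForm b τ ξ ω := by
  filter_upwards [ae_summable_quadForm hξ h] with ω hω
  have h0 : ∀ j, 0 ≤ b j * (ξ j ω + τ j) ^ 2 := fun j => mul_nonneg (h.nonneg j) (sq_nonneg _)
  exact ⟨hω.hasSum.tendsto_sum_nat, fun N => ⟨Finset.sum_nonneg fun j _ => h0 j,
    hω.sum_le_tsum _ fun j _ => h0 j⟩⟩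

lemma aemeasurable_quadForm [IsProbabilityMeasure P] (hξ : ∀ j, P.map (ξ j) = gaussianReal 0 1)
    (h : IsWeightSystem b (fun j => b j * τ j ^ 2) β) : AEMeasurable (quadForm b τ ξ) P :=
  aemeasurable_of_tendsto_metrizable_ae' (aemeasurable_partialForm hξ)
    ((ae_tendsto_partialForm hξ h).mono fun _ h => h.1)

lemma IsWeightSystem.hasSum_squareTerm (h : IsWeightSystem b (fun j => b j * τ j ^ 2) β) {z : ℂ}
    (hz : z.re * β ≤ 1 / 4) :
    HasSum (fun j => squareTerm (b j) (b j * τ j ^ 2) z)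
      (cumulant b (fun j => b j * τ j ^ 2) z +
        (z * (∑' j, b j : ℝ) + z * (∑' j, b j * τ j ^ 2 : ℝ))) := by
  have h1 := (h.summable_cumulantTerm hz).hasSum
  have h2 := (Complex.hasSum_ofReal.2 h.summable.hasSum).mul_left z
  have h3 := (Complex.hasSum_ofReal.2 h.summable_noncentrality.hasSum).mul_left z
  rw [cumulant]
  refine (h1.add (h2.add h3)).congr_fun fun j => ?_
  refine squareTerm_eq fun h0 => ?_
  have := half_le_re_one_sub (h.nonneg j) (h.le_bound j) hz
  rw [h0, Complex.zero_re] at this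
  linarith

/-- Fatou's lemma along the partial sums, whose transforms converge. -/
lemma integrable_exp_quadForm [IsProbabilityMeasure P]
    (hξ : ∀ j, P.map (ξ j) = gaussianReal 0 1) (hind : iIndepFun ξ P)
    (h : IsWeightSystem b (fun j => b j * τ j ^ 2) β) {t : ℝ} (ht : t * β ≤ 1 / 4) :
    Integrable (fun ω => Real.exp (t * quadForm b τ ξ ω)) P := by
  have hQ := aemeasurable_quadForm hξ h
  refine ⟨AEMeasurable.aestronglyMeasurable (by fun_prop), ?_⟩
  rw [hasFiniteIntegral_iff_ofReal (ae_of_all _ fun ω => (Real.exp_pos _).le)]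
  have hz : ((t : ℂ)).re * β ≤ 1 / 4 := by simpa using ht
  have hlim := (Complex.continuous_exp.tendsto _).comp
    (h.hasSum_squareTerm hz).tendsto_sum_nat
  have hnorm : Tendsto (fun N => ‖Complex.exp (∑ j ∈ Finset.range N,
      squareTerm (b j) (b j * τ j ^ 2) t)‖) atTop _ := hlim.norm
  have hint : ∀ N, ∫⁻ ω, ENNReal.ofReal (Real.exp (t * partialForm b τ ξ N ω)) ∂P =
      ENNReal.ofReal ‖Complex.exp (∑ j ∈ Finset.range N, squareTerm (b j) (b j * τ j ^ 2) t)‖ := by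
    intro N
    rw [← complexMGF_partialForm hξ hind h.nonneg h.le_bound hz, complexMGF_ofReal,
      Complex.norm_real, Real.norm_of_nonneg mgf_nonneg, mgf,
      ofReal_integral_eq_lintegral_ofReal
        (integrable_exp_partialForm hξ hind h.nonneg h.le_bound ht N)
        (ae_of_all _ fun ω => (Real.exp_pos _).le)]
  have hfatou : ∫⁻ ω, ENNReal.ofReal (Real.exp (t * quadForm b τ ξ ω)) ∂P ≤
      liminf (fun N => ∫⁻ ω, ENNReal.ofReal (Real.exp (t * partialForm b τ ξ N ω)) ∂P) atTop := by
    refine le_trans (lintegral_mono_ae ?_) (lintegral_liminf_le' fun N => ?_)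
    · filter_upwards [ae_tendsto_partialForm hξ h] with ω hω
      refine le_of_eq (Tendsto.liminf_eq ?_).symm
      exact ENNReal.tendsto_ofReal ((Real.continuous_exp.tendsto _).comp (hω.1.const_mul t))
    · have := aemeasurable_partialForm (b := b) (τ := τ) hξ N
      fun_prop
  simp_rw [hint] at hfatou
  rw [(ENNReal.tendsto_ofReal hnorm).liminf_eq] at hfatou
  exact hfatou.trans_lt ENNReal.ofReal_lt_top

/-- The partial sums lie between `0` and the full form `Q`, so `e^{max(Re z, 0) Q}` dominates and
the formula passes to the limit. -/
lemma complexMGF_quadForm [IsProbabilityMeasure P]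
    (hξ : ∀ j, P.map (ξ j) = gaussianReal 0 1) (hind : iIndepFun ξ P)
    (h : IsWeightSystem b (fun j => b j * τ j ^ 2) β) {z : ℂ} (hz : z.re * β ≤ 1 / 4) :
    complexMGF (quadForm b τ ξ) P z =
      Complex.exp (cumulant b (fun j => b j * τ j ^ 2) z +
        (z * (∑' j, b j : ℝ) + z * (∑' j, b j * τ j ^ 2 : ℝ))) := by
  have hlim := (Complex.continuous_exp.tendsto _).comp
    (h.hasSum_squareTerm hz).tendsto_sum_nat
  have hmax : max z.re 0 * β ≤ 1 / 4 := by
    rcases le_total 0 z.re with h0 | h0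
    · rwa [max_eq_left h0]
    · rw [max_eq_right h0]; norm_num
  have hlim' : Tendsto (fun N => complexMGF (partialForm b τ ξ N) P z) atTop
      (𝓝 (complexMGF (quadForm b τ ξ) P z)) := by
    refine tendsto_integral_of_dominated_convergence _ (fun N => ?_)
      (integrable_exp_quadForm hξ hind h hmax) (fun N => ?_) ?_
    · have := aemeasurable_partialForm (b := b) (τ := τ) hξ N
      exact AEMeasurable.aestronglyMeasurable (by fun_prop)
    · filter_upwards [ae_tendsto_partialForm hξ h] with ω hω
      rw [Complex.norm_exp, Complex.re_mul_ofReal, Real.exp_le_exp]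
      exact mul_le_mul (le_max_left _ _) (hω.2 N).2 (hω.2 N).1 (le_max_right _ _)
    · filter_upwards [ae_tendsto_partialForm hξ h] with ω hω
      refine (Complex.continuous_exp.tendsto _).comp (Tendsto.const_mul z ?_)
      exact (Complex.continuous_ofReal.tendsto _).comp hω.1
  refine tendsto_nhds_unique hlim' (hlim.congr fun N => ?_)
  exact (complexMGF_partialForm hξ hind h.nonneg h.le_bound hz N).symm

/-! ### Centred forms: near-Gaussianity, reflection and positivity of lower tails. -/

/-- A Gaussian quadratic form, centred at its mean. -/
noncomputable def centredForm (b τ : ℕ → ℝ) (ξ : ℕ → Ω → ℝ) (ω : Ω) : ℝ :=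
  quadForm b τ ξ ω - (∑' j, b j + ∑' j, b j * τ j ^ 2)

lemma complexMGF_centredForm [IsProbabilityMeasure P]
    (hξ : ∀ j, P.map (ξ j) = gaussianReal 0 1) (hind : iIndepFun ξ P)
    (h : IsWeightSystem b (fun j => b j * τ j ^ 2) β) {z : ℂ} (hz : z.re * β ≤ 1 / 4) :
    complexMGF (centredForm b τ ξ) P z =
      Complex.exp (cumulant b (fun j => b j * τ j ^ 2) z) := by
  have h1 := complexMGF_quadForm hξ hind h hz
  set s : ℂ := z * (∑' j, b j : ℝ) + z * (∑' j, b j * τ j ^ 2 : ℝ)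
  have h2 : complexMGF (centredForm b τ ξ) P z =
      complexMGF (quadForm b τ ξ) P z * Complex.exp (-s) := by
    simp only [complexMGF]
    rw [← integral_mul_const]
    refine integral_congr_ae (ae_of_all _ fun ω => ?_)
    simp only
    rw [← Complex.exp_add, centredForm]
    congr 1
    simp only [s]
    push_cast
    ring
  rw [h2, h1, ← Complex.exp_add, add_neg_cancel_right]

lemma integrable_exp_centredForm [IsProbabilityMeasure P]
    (hξ : ∀ j, P.map (ξ j) = gaussianReal 0 1) (hind : iIndepFun ξ P)
    (h : IsWeightSystem b (fun j => b j * τ j ^ 2) β) {t : ℝ} (ht : t * β ≤ 1 / 4) :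
    Integrable (fun ω => Real.exp (t * centredForm b τ ξ ω)) P := by
  have h1 := (integrable_exp_quadForm hξ hind h ht).mul_const
    (Real.exp (-(t * (∑' j, b j + ∑' j, b j * τ j ^ 2))))
  refine h1.congr (ae_of_all _ fun ω => ?_)
  simp only
  rw [← Real.exp_add, centredForm]
  ring_nf

theorem nearGaussian_centredForm [IsProbabilityMeasure P]
    (hξ : ∀ j, P.map (ξ j) = gaussianReal 0 1) (hind : iIndepFun ξ P)
    (h : IsWeightSystem b (fun j => b j * τ j ^ 2) β) :
    NearGaussian P (centredForm b τ ξ) β (∑' j, b j * τ j ^ 2) where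
  aemeasurable := (aemeasurable_quadForm hξ h).sub_const _
  bound_nonneg := h.bound_nonneg
  integrable_exp t ht := integrable_exp_centredForm hξ hind h
    ((mul_le_mul_of_nonneg_right (le_abs_self t) h.bound_nonneg).trans ht)
  exists_cumulant := ⟨cumulant b fun j => b j * τ j ^ 2,
    fun _ hz => complexMGF_centredForm hξ hind h
      ((mul_le_mul_of_nonneg_right (le_abs_self _) h.bound_nonneg).trans hz),
    fun _ hz => h.norm_cumulant_sub_le hz, fun hβ _ u ht => h.re_cumulant_le hβ ht u⟩

/-- All bounds depend only on `|t|`, `‖z‖` and `u²`, so reflection replaces `K(z)` by `K(-z)`. This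
turns the left tails of type II errors into right tails. -/
lemma NearGaussian.neg {X : Ω → ℝ} {B : ℝ} (h : NearGaussian P X β B) :
    NearGaussian P (fun ω => -X ω) β B where
  aemeasurable := h.aemeasurable.neg
  bound_nonneg := h.bound_nonneg
  integrable_exp t ht := by simpa using h.integrable_exp (-t) (by rwa [abs_neg])
  exists_cumulant := by
    obtain ⟨K, h1, h2, h3⟩ := h.exists_cumulant
    refine ⟨fun z => K (-z), fun z hz => ?_, fun z hz => ?_, fun hβ t u ht => ?_⟩
    · rw [← h1 (-z) (by simpa using hz)]
      simp [complexMGF]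
    · simpa using h2 (-z) (by simpa using hz)
    · have := h3 hβ (-t) (-u) (by rwa [abs_neg])
      simp only [neg_sq, Complex.ofReal_neg] at this
      convert this using 3
      ring_nf

/-- The central part is nonnegative since `log (1 + 2sb) ≤ 2sb`; only the noncentral part remains.
-/
lemma re_cumulantTerm_neg_ge {b d s : ℝ} (hb : 0 ≤ b) (hs : 0 ≤ s) :
    s * d - s * d / (1 + 2 * s * b) ≤ (cumulantTerm b d ((-s : ℝ) : ℂ)).re := by
  have hp : 0 < 1 + 2 * s * b := by positivity
  have h1 : cumulantTerm b d ((-s : ℝ) : ℂ) =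
      ((-(1 / 2) * Real.log (1 + 2 * s * b) + s * b + 2 * s ^ 2 * b * d / (1 + 2 * s * b) : ℝ) : ℂ) := by
    have h2 : (1 - 2 * ((-s : ℝ) : ℂ) * b) = ((1 + 2 * s * b : ℝ) : ℂ) := by push_cast; ring
    rw [cumulantTerm, h2, ← Complex.ofReal_log hp.le]
    push_cast
    ring
  rw [h1, Complex.ofReal_re]
  have h3 := Real.log_le_sub_one_of_pos hp
  have h4 : 2 * s ^ 2 * b * d / (1 + 2 * s * b) = s * d - s * d / (1 + 2 * s * b) := by
    field_simp
    ring
  linarith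

/-- A Gaussian quadratic form takes values arbitrarily close to zero with positive probability. -/
theorem measureReal_centredForm_le_pos [IsProbabilityMeasure P]
    (hξ : ∀ j, P.map (ξ j) = gaussianReal 0 1) (hind : iIndepFun ξ P)
    (h : IsWeightSystem b (fun j => b j * τ j ^ 2) β) {x : ℝ} (hx : 0 < x) :
    0 < P.real {ω | centredForm b τ ξ ω ≤ x - ∑' j, b j * τ j ^ 2} := by
  refine lt_of_le_of_ne measureReal_nonneg fun hzero => ?_
  set B := ∑' j, b j * τ j ^ 2 with hB
  have hae : ∀ᵐ ω ∂P, x - B ≤ centredForm b τ ξ ω := by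
    have h0 : P {ω | centredForm b τ ξ ω ≤ x - B} = 0 :=
      (measureReal_eq_zero_iff (measure_ne_top _ _)).1 hzero.symm
    have h1 : ∀ᵐ ω ∂P, ¬ centredForm b τ ξ ω ≤ x - B := by
      rw [ae_iff]; simpa using h0
    exact h1.mono fun ω hω => (not_le.1 hω).le
  have hd := h.summable_noncentrality
  have hsum : ∀ s : ℝ, 0 ≤ s → Summable fun j => b j * τ j ^ 2 / (1 + 2 * s * b j) := by
    intro s hs
    refine Summable.of_nonneg_of_le (fun j => ?_) (fun j => ?_) hd
    · have := h.nonneg j; positivity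
    · refine div_le_self (h.nonneg_noncentrality j) ?_
      have := mul_nonneg (mul_nonneg zero_le_two hs) (h.nonneg j)
      linarith
  -- An almost sure lower bound on the form bounds its Laplace transform at `-s` from above;
  -- comparing with the explicit cumulant leaves a sum that vanishes as `s → ∞`, contradicting `x >
  -- 0`.
  have hkey : ∀ s : ℝ, 0 < s → x ≤ ∑' j, b j * τ j ^ 2 / (1 + 2 * s * b j) := by
    intro s hs
    have hsβ : -s * β ≤ 1 / 4 := by nlinarith [h.bound_nonneg]
    have hz : (((-s : ℝ) : ℂ)).re * β ≤ 1 / 4 := by rwa [Complex.ofReal_re]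
    have hm : mgf (centredForm b τ ξ) P (-s) ≤ Real.exp (-s * (x - B)) := by
      have h1 := integral_mono_ae (integrable_exp_centredForm hξ hind h hsβ)
        (integrable_const (Real.exp (-s * (x - B)))) (hae.mono fun ω hω => by
          simp only [Real.exp_le_exp]; nlinarith)
      simpa [mgf] using h1
    have hc := congrArg norm (complexMGF_centredForm hξ hind h hz)
    rw [complexMGF_ofReal, Complex.norm_real, Real.norm_of_nonneg mgf_nonneg,
      Complex.norm_exp] at hc
    rw [hc, Real.exp_le_exp] at hm
    have hlow := hasSum_le (fun j => re_cumulantTerm_neg_ge (d := b j * τ j ^ 2) (h.nonneg j) hs.le)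
      ((hd.hasSum.mul_left s).sub (by
        simpa only [mul_div_assoc s] using (hsum s hs.le).hasSum.mul_left s))
      (Complex.hasSum_re (h.summable_cumulantTerm hz).hasSum)
    have := hlow.trans hm
    rw [← hB] at this
    have h2 : s * x ≤ s * ∑' j, b j * τ j ^ 2 / (1 + 2 * s * b j) := by linarith
    exact le_of_mul_le_mul_left h2 hs
  have hlim : Tendsto (fun s : ℝ => ∑' j, b j * τ j ^ 2 / (1 + 2 * s * b j)) atTop
      (𝓝 (∑' _j : ℕ, 0)) := by
    refine tendsto_tsum_of_dominated_convergence hd (fun j => ?_) ?_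
    -- A zero weight would stop the denominator from growing, but it also annihilates the
    -- noncentrality `b_j τ_j²`.
    · rcases (h.nonneg j).eq_or_lt with h0 | h0
      · simp [← h0]
      · refine tendsto_const_nhds.div_atTop (tendsto_atTop_add_const_left _ _ ?_)
        exact (tendsto_id.const_mul_atTop two_pos).atTop_mul_const h0
    · filter_upwards [eventually_ge_atTop 0] with s hs j
      have hb := h.nonneg j
      rw [Real.norm_of_nonneg (by positivity)]
      refine div_le_self (h.nonneg_noncentrality j) ?_
      have := mul_nonneg (mul_nonneg zero_le_two hs) hb
      linarith
  rw [tsum_zero] at hlim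
  exact absurd (ge_of_tendsto hlim ((eventually_gt_atTop 0).mono hkey)) (not_le.2 hx)

end NeymanTest

namespace NeymanTest

/-! ### The test statistic as a Gaussian quadratic form -/

/-- The weights `ϰ_{εj}² ε⁻² (2 A_ε)^{-1/2}` of the standardized statistic. -/
noncomputable def weight (κ : ℝ → ℕ → ℝ) (ε : ℝ) (j : ℕ) : ℝ :=
  κ ε (j + 1) ^ 2 * ((ε ^ 2)⁻¹ * (√(2 * A κ ε))⁻¹)

/-- The normalized signal coefficients `θ_j / ε`. -/
noncomputable def shift (φ : ℕ → Signal) (ε : ℝ) (S : Signal) (j : ℕ) : ℝ :=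
  fourierCoeff φ S (j + 1) / ε

/-- The centred part of the standardized statistic. -/
noncomputable def centredStatistic {Ω : Type*} (W : Signal → Ω → ℝ) (φ : ℕ → Signal)
    (κ : ℝ → ℕ → ℝ) (ε : ℝ) (S : Signal) : Ω → ℝ :=
  centredForm (weight κ ε) (shift φ ε S) (fun j => W (φ (j + 1)))

section Setup

variable {Ω : Type*} [MeasurableSpace Ω] {P : Measure Ω} {W : Signal → Ω → ℝ}
  {φ : ℕ → Signal} {κ : ℝ → ℕ → ℝ} {ε : ℝ}

lemma IsGaussianWhiteNoise.map_eq (hW : IsGaussianWhiteNoise W P)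
    (hφ : Orthonormal ℝ (fun j : ℕ => φ (j + 1))) (j : ℕ) :
    P.map (W (φ (j + 1))) = gaussianReal 0 1 := by
  have hg := hW.isGaussianProcess.hasGaussianLaw_eval (φ (j + 1))
  have hv : Var[W (φ (j + 1)); P] = 1 := by
    rw [← covariance_self hg.aemeasurable, hW.covariance_eq, real_inner_self_eq_norm_sq,
      hφ.1 j, one_pow]
  rw [hg.map_eq_gaussianReal, hW.mean_eq_zero, hv, Real.toNNReal_one]

lemma IsGaussianWhiteNoise.iIndepFun (hW : IsGaussianWhiteNoise W P)
    (hφ : Orthonormal ℝ (fun j : ℕ => φ (j + 1))) :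
    iIndepFun (fun j : ℕ => W (φ (j + 1))) P := by
  -- Each coordinate is viewed as a process on a one-point index set; orthogonality makes these
  -- jointly Gaussian processes uncorrelated.
  have h := IsGaussianProcess.iIndepFun_of_covariance_eq_zero (T := ℕ) (S := fun _ => Unit)
    (X := fun j _ => W (φ (j + 1))) (P := P)
    (hW.isGaussianProcess.comp_right fun p : (_ : ℕ) × Unit => φ (p.1 + 1))
    (fun j _ => hW.isGaussianProcess.aemeasurable _)
    (fun i j hij _ _ => by rw [hW.covariance_eq]; exact hφ.2 hij)
  exact h.comp (fun _ f => f ()) fun _ => measurable_pi_apply _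

lemma A_pos (hA2 : AssumptionA2 κ) (hε : 0 < ε) : 0 < A κ ε := by
  obtain ⟨C₁, C₂, hC₁, h⟩ := hA2
  exact hC₁.trans (h ε hε).1

lemma weight_nonneg (j : ℕ) : 0 ≤ weight κ ε j := by
  unfold weight; positivity

lemma tsum_pow_four_pos (hε : 0 < ε) (hA : 0 < A κ ε) : 0 < ∑' j : ℕ, κ ε (j + 1) ^ 4 := by
  rw [A] at hA
  exact (pos_iff_pos_of_mul_pos hA).1 (by positivity)

/-- A divergent sum would have the default value zero, making `A` zero. -/
lemma summable_pow_four (hε : 0 < ε) (hA : 0 < A κ ε) : Summable fun j : ℕ => κ ε (j + 1) ^ 4 := by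
  by_contra h
  exact (tsum_pow_four_pos hε hA).ne' (tsum_eq_zero_of_not_summable h)

lemma weight_sq (hA : 0 < A κ ε) (j : ℕ) :
    weight κ ε j ^ 2 = (ε ^ 4)⁻¹ * κ ε (j + 1) ^ 4 / (2 * A κ ε) := by
  rw [weight, mul_pow, mul_pow, inv_pow, inv_pow, Real.sq_sqrt (by positivity)]
  ring

/-- A1 makes the first weight the largest, Bessel's inequality makes the noncentralities summable,
and division by `√(2A)` normalizes the squared weights. -/
lemma isWeightSystem (hφ : Orthonormal ℝ (fun j : ℕ => φ (j + 1)))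
    (hκ : ∀ ε > 0, Summable (fun j : ℕ => κ ε (j + 1) ^ 2)) (hA1 : AssumptionA1 κ)
    (hA2 : AssumptionA2 κ) (hε : 0 < ε) (S : Signal) :
    IsWeightSystem (weight κ ε) (fun j => weight κ ε j * shift φ ε S j ^ 2) (weight κ ε 0) := by
  have hA := A_pos hA2 hε
  have hle : ∀ j, weight κ ε j ≤ weight κ ε 0 := by
    intro j
    unfold weight
    refine mul_le_mul_of_nonneg_right ?_ (by positivity)
    exact hA1 ε hε (by simp) (by simp) (by omega)
  have hbessel : Summable fun j => shift φ ε S j ^ 2 := by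
    have h := (Orthonormal.inner_products_summable (x := S) hφ).div_const (ε ^ 2)
    refine h.congr fun j => ?_
    rw [shift, div_pow, fourierCoeff, Real.norm_eq_abs, sq_abs]
  refine ⟨weight_nonneg, hle, fun j => mul_nonneg (weight_nonneg j) (sq_nonneg _),
    (hκ ε hε).mul_right _, ?_, ?_⟩
  · refine Summable.of_nonneg_of_le (fun j => mul_nonneg (weight_nonneg j) (sq_nonneg _))
      (fun j => mul_le_mul_of_nonneg_right (hle j) (sq_nonneg _)) (hbessel.mul_left _)
  · have h := ((summable_pow_four hε hA).hasSum.mul_left (ε ^ 4)⁻¹).div_const (2 * A κ ε)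
    have hval : (ε ^ 4)⁻¹ * ∑' j : ℕ, κ ε (j + 1) ^ 4 = A κ ε := rfl
    rw [hval] at h
    have h2 : A κ ε / (2 * A κ ε) = 1 / 2 := by field_simp
    rw [h2] at h
    exact h.congr_fun fun j => weight_sq hA j

lemma tsum_weight_mul_shift_sq (hε : 0 < ε) (S : Signal) :
    ∑' j, weight κ ε j * shift φ ε S j ^ 2 = B φ κ ε S := by
  rw [B, D, ← tsum_mul_left, ← tsum_div_const]
  refine tsum_congr fun j => ?_
  rw [weight, shift]
  field_simp

/-- Writing `y_j = ε (ξ_j + θ_j/ε)` makes this an identity at every `ω`: pulling constants out of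
`tsum` needs no summability. -/
lemma standardized_statistic_eq {Ω : Type*} {W : Signal → Ω → ℝ} (hε : 0 < ε) (S : Signal)
    (ω : Ω) :
    (ε ^ 2)⁻¹ * (√(2 * A κ ε))⁻¹ * statistic κ ε (observation W φ ε S ω) =
      centredStatistic W φ κ ε S ω + B φ κ ε S := by
  have h1 : ∑' j : ℕ, κ ε (j + 1) ^ 2 * observation W φ ε S ω (j + 1) ^ 2 =
      ∑' j : ℕ, ε ^ 2 * (κ ε (j + 1) ^ 2 * (W (φ (j + 1)) ω + shift φ ε S j) ^ 2) := by
    refine tsum_congr fun j => ?_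
    rw [observation, shift]
    field_simp
    ring
  have h2 : quadForm (weight κ ε) (shift φ ε S) (fun j => W (φ (j + 1))) ω =
      ((ε ^ 2)⁻¹ * (√(2 * A κ ε))⁻¹) *
        ∑' j : ℕ, κ ε (j + 1) ^ 2 * (W (φ (j + 1)) ω + shift φ ε S j) ^ 2 := by
    rw [quadForm, ← tsum_mul_left]
    refine tsum_congr fun j => ?_
    rw [weight]; ring
  have h3 : ∑' j, weight κ ε j = ((ε ^ 2)⁻¹ * (√(2 * A κ ε))⁻¹) * rhoSq κ ε := by
    rw [rhoSq, ← tsum_mul_left]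
    refine tsum_congr fun j => ?_
    rw [weight]; ring
  rw [statistic, h1, tsum_mul_left, ← mul_assoc (ε ^ 2)⁻¹ (ε ^ 2),
    inv_mul_cancel₀ (by positivity), one_mul, mul_sub, ← h2, ← h3, centredStatistic, centredForm,
    tsum_weight_mul_shift_sq hε]
  ring

lemma B_zero : B φ κ ε 0 = 0 := by
  simp [B, D, fourierCoeff]

lemma B_nonneg (S : Signal) : 0 ≤ B φ κ ε S := by
  unfold B D
  have : 0 ≤ ∑' j : ℕ, κ ε (j + 1) ^ 2 * fourierCoeff φ S (j + 1) ^ 2 :=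
    tsum_nonneg fun j => by positivity
  positivity

variable [IsProbabilityMeasure P]

lemma nearGaussian_centredStatistic (hW : IsGaussianWhiteNoise W P)
    (hφ : Orthonormal ℝ (fun j : ℕ => φ (j + 1)))
    (hκ : ∀ ε > 0, Summable (fun j : ℕ => κ ε (j + 1) ^ 2)) (hA1 : AssumptionA1 κ)
    (hA2 : AssumptionA2 κ) (hε : 0 < ε) (S : Signal) :
    NearGaussian P (centredStatistic W φ κ ε S) (weight κ ε 0) (B φ κ ε S) := by
  rw [← tsum_weight_mul_shift_sq hε]
  exact nearGaussian_centredForm (hW.map_eq hφ) (hW.iIndepFun hφ)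
    (isWeightSystem hφ hκ hA1 hA2 hε S)

lemma integral_test {S : Signal} (hm : AEMeasurable (centredStatistic W φ κ ε S) P)
    (hε : 0 < ε) (x : ℝ) :
    ∫ ω, test κ ε x (observation W φ ε S ω) ∂P =
      P.real {ω | x - B φ κ ε S < centredStatistic W φ κ ε S ω} ∧
    Integrable (fun ω => test κ ε x (observation W φ ε S ω)) P := by
  have hms : NullMeasurableSet {ω | x - B φ κ ε S < centredStatistic W φ κ ε S ω} P :=
    nullMeasurableSet_lt aemeasurable_const hm
  have heq : (fun ω => test κ ε x (observation W φ ε S ω)) =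
      Set.indicator {ω | x - B φ κ ε S < centredStatistic W φ κ ε S ω} fun _ => 1 := by
    funext ω
    have hiff : observation W φ ε S ω ∈
        {z : ℕ → ℝ | x < (ε ^ 2)⁻¹ * (√(2 * A κ ε))⁻¹ * statistic κ ε z} ↔
        ω ∈ {ω | x - B φ κ ε S < centredStatistic W φ κ ε S ω} := by
      simp only [Set.mem_ofPred_eq, standardized_statistic_eq hε, sub_lt_iff_lt_add]
    by_cases h : ω ∈ {ω | x - B φ κ ε S < centredStatistic W φ κ ε S ω}
    · rw [test, Set.indicator_of_mem (hiff.2 h), Set.indicator_of_mem h]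
    · rw [test, Set.indicator_of_notMem (fun h' => h (hiff.1 h')), Set.indicator_of_notMem h]
  constructor
  · rw [heq, integral_indicator₀ hms, setIntegral_const, smul_eq_mul, mul_one]
  · rw [heq]
    exact (integrable_const _).indicator₀ hms

lemma typeI_eq (hm : AEMeasurable (centredStatistic W φ κ ε 0) P) (hε : 0 < ε) (x : ℝ) :
    typeI P W φ κ ε x = P.real {ω | x < centredStatistic W φ κ ε 0 ω} := by
  rw [typeI, (integral_test hm hε x).1, B_zero, sub_zero]

lemma typeII_eq {S : Signal} (hm : AEMeasurable (centredStatistic W φ κ ε S) P) (hε : 0 < ε)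
    (x : ℝ) :
    typeII P W φ κ ε x S =
      P.real {ω | B φ κ ε S - x ≤ -centredStatistic W φ κ ε S ω} := by
  have hms : NullMeasurableSet {ω | x - B φ κ ε S < centredStatistic W φ κ ε S ω} P :=
    nullMeasurableSet_lt aemeasurable_const hm
  obtain ⟨h1, h2⟩ := integral_test hm hε x
  have hset : {ω | B φ κ ε S - x ≤ -centredStatistic W φ κ ε S ω} =
      {ω | x - B φ κ ε S < centredStatistic W φ κ ε S ω}ᶜ := by
    ext ω
    simp only [Set.mem_ofPred_eq, Set.mem_compl_iff, not_lt]
    constructor <;> intro h <;> linarith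
  rw [typeII, integral_sub (integrable_const _) h2, h1, hset, probReal_compl_eq_one_sub₀ hms]
  simp

/-- Needed for the divergence of `|log β|`: a vanishing error would give logarithm zero by default.
-/
lemma typeII_pos (hW : IsGaussianWhiteNoise W P)
    (hφ : Orthonormal ℝ (fun j : ℕ => φ (j + 1)))
    (hκ : ∀ ε > 0, Summable (fun j : ℕ => κ ε (j + 1) ^ 2)) (hA1 : AssumptionA1 κ)
    (hA2 : AssumptionA2 κ) (hε : 0 < ε) (S : Signal) {x : ℝ} (hx : 0 < x) :
    0 < typeII P W φ κ ε x S := by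
  rw [typeII_eq (nearGaussian_centredStatistic hW hφ hκ hA1 hA2 hε S).aemeasurable hε]
  have h := measureReal_centredForm_le_pos (hW.map_eq hφ) (hW.iIndepFun hφ)
    (isWeightSystem hφ hκ hA1 hA2 hε S) hx
  rw [tsum_weight_mul_shift_sq hε] at h
  refine h.trans_eq ?_
  congr 1
  ext ω
  simp only [Set.mem_ofPred_eq, centredStatistic]
  constructor <;> intro h <;> linarith

end Setup

/-! ### The maximal weight -/

/-- By monotonicity each of the first `k` terms is at least the `k`-th. -/
lemma kIndex_mul_kappaSq_sq_le {κ : ℝ → ℕ → ℝ} {ε : ℝ} (hA1 : AssumptionA1 κ) (hε : 0 < ε)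
    (hA : 0 < A κ ε) :
    (kIndex κ ε : ℝ) * kappaSq κ ε ^ 2 ≤ ∑' j : ℕ, κ ε (j + 1) ^ 4 := by
  have hs := summable_pow_four hε hA
  refine le_trans ?_ (hs.sum_le_tsum (Finset.range (kIndex κ ε)) fun j _ => by positivity)
  rw [← nsmul_eq_mul]
  refine (Finset.card_nsmul_le_sum _ _ _ fun j hj => ?_).trans' (by rw [Finset.card_range])
  have hj' := Finset.mem_range.1 hj
  have h : κ ε (kIndex κ ε) ^ 2 ≤ κ ε (j + 1) ^ 2 :=
    hA1 ε hε (Set.mem_Ici.2 (by omega)) (Set.mem_Ici.2 (by omega)) (by omega)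
  calc kappaSq κ ε ^ 2 = (κ ε (kIndex κ ε) ^ 2) ^ 2 := rfl
    _ ≤ (κ ε (j + 1) ^ 2) ^ 2 := by gcongr
    _ = _ := by ring

/-- The squared largest weight is `κ₁⁴ / (2 ∑ κ_j⁴)`. A4 replaces `κ₁⁴` by a multiple of `κ_k⁴`, and
`k κ_k⁴ ≤ ∑ κ_j⁴`. -/
lemma exists_weight_zero_mul_le {κ : ℝ → ℕ → ℝ} (hA1 : AssumptionA1 κ) (hA2 : AssumptionA2 κ)
    (hA4 : AssumptionA4 κ) :
    ∃ C > 0, ∀ᶠ ε in 𝓝[>] 0, weight κ ε 0 * (kIndex κ ε : ℝ) ^ (1 / 2 : ℝ) ≤ C := by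
  obtain ⟨c, hc, hbound⟩ := hA4.1.1.exists_pos
  refine ⟨c, hc, ?_⟩
  filter_upwards [hbound.bound, self_mem_nhdsWithin] with ε hb (hε : 0 < ε)
  have hA := A_pos hA2 hε
  have hk := kIndex_mul_kappaSq_sq_le hA1 hε hA
  have hT := tsum_pow_four_pos hε hA
  have hkap : 0 ≤ kappaSq κ ε := sq_nonneg _
  rw [Real.norm_of_nonneg (sq_nonneg _), Real.norm_of_nonneg hkap] at hb
  rw [← Real.sqrt_eq_rpow]
  refine le_of_sq_le_sq ?_ hc.le
  rw [mul_pow, Real.sq_sqrt (Nat.cast_nonneg _), weight_sq hA, zero_add]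
  have h4 : κ ε 1 ^ 4 ≤ c ^ 2 * kappaSq κ ε ^ 2 := by
    calc κ ε 1 ^ 4 = (κ ε 1 ^ 2) ^ 2 := by ring
      _ ≤ (c * kappaSq κ ε) ^ 2 := by gcongr
      _ = _ := by ring
  have hAeq : (ε ^ 4)⁻¹ * κ ε 1 ^ 4 / (2 * A κ ε) =
      κ ε 1 ^ 4 / (2 * ∑' j : ℕ, κ ε (j + 1) ^ 4) := by
    rw [A]; field_simp
  rw [hAeq, div_mul_eq_mul_div, div_le_iff₀ (by positivity)]
  calc κ ε 1 ^ 4 * (kIndex κ ε : ℝ) ≤ c ^ 2 * kappaSq κ ε ^ 2 * (kIndex κ ε : ℝ) := by gcongr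
    _ = c ^ 2 * ((kIndex κ ε : ℝ) * kappaSq κ ε ^ 2) := by ring
    _ ≤ c ^ 2 * ∑' j : ℕ, κ ε (j + 1) ^ 4 := by gcongr
    _ ≤ _ := by nlinarith [mul_pos (pow_pos hc 2) hT]

lemma isBigO_weight_zero_mul {κ : ℝ → ℕ → ℝ} (hA1 : AssumptionA1 κ) (hA2 : AssumptionA2 κ)
    (hA4 : AssumptionA4 κ) :
    (fun ε => weight κ ε 0 * (kIndex κ ε : ℝ) ^ (1 / 2 : ℝ)) =O[𝓝[>] 0] fun _ => (1 : ℝ) := by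
  obtain ⟨C, _, hC⟩ := exists_weight_zero_mul_le hA1 hA2 hA4
  refine IsBigO.of_bound C (hC.mono fun ε h => ?_)
  rw [Real.norm_of_nonneg (mul_nonneg (weight_nonneg 0) (by positivity)), norm_one, mul_one]
  exact h

lemma tendsto_weight_zero_mul {κ : ℝ → ℕ → ℝ} (hA1 : AssumptionA1 κ) (hA2 : AssumptionA2 κ)
    (hA4 : AssumptionA4 κ) {f : ℝ → ℝ}
    (hf : f =o[𝓝[>] 0] fun ε => (kIndex κ ε : ℝ) ^ (1 / 2 : ℝ)) :
    Tendsto (fun ε => weight κ ε 0 * f ε) (𝓝[>] 0) (𝓝 0) :=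
  (isLittleO_one_iff ℝ).1 (((isBigO_refl (fun ε => weight κ ε 0) _).mul_isLittleO hf).trans_isBigO
    (isBigO_weight_zero_mul hA1 hA2 hA4))

lemma isLittleO_pow_three {κ : ℝ → ℕ → ℝ} {f : ℝ → ℝ}
    (hf : f =o[𝓝[>] 0] fun ε => (kIndex κ ε : ℝ) ^ (1 / 6 : ℝ)) :
    (fun ε => f ε ^ 3) =o[𝓝[>] 0] fun ε => (kIndex κ ε : ℝ) ^ (1 / 2 : ℝ) := by
  refine (hf.pow (n := 3) (by norm_num)).congr_right fun ε => ?_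
  rw [← Real.rpow_natCast, ← Real.rpow_mul (Nat.cast_nonneg _)]
  norm_num

end NeymanTest

namespace NeymanTest

/-! ### Error probabilities -/

lemma eventually_pos_nhdsGT : ∀ᶠ ε : ℝ in 𝓝[>] 0, 0 < ε := self_mem_nhdsWithin

lemma tendsto_B {φ : ℕ → Signal} {κ : ℝ → ℕ → ℝ} (hA2 : AssumptionA2 κ) {S : ℝ → Signal}
    (hD : Tendsto (fun ε => D φ κ ε (S ε)) (𝓝[>] 0) atTop) :
    Tendsto (fun ε => B φ κ ε (S ε)) (𝓝[>] 0) atTop := by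
  obtain ⟨C₁, C₂, hC₁, h⟩ := hA2
  have hC : ∀ᶠ ε : ℝ in 𝓝[>] 0, D φ κ ε (S ε) / √(2 * C₂) ≤ B φ κ ε (S ε) := by
    filter_upwards [eventually_pos_nhdsGT, hD.eventually_ge_atTop 0] with ε hε hDε
    obtain ⟨h1, h2⟩ := h ε hε
    have hA : 0 < A κ ε := hC₁.trans h1
    rw [B]
    gcongr
  have hC₂ : 0 < C₂ := by
    have := h 1 one_pos
    exact hC₁.trans (this.1.trans this.2)
  exact tendsto_atTop_mono' _ hC (hD.atTop_div_const (by positivity))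

lemma isBigO_B {φ : ℕ → Signal} {κ : ℝ → ℕ → ℝ} (hA2 : AssumptionA2 κ) (S : ℝ → Signal) :
    (fun ε => B φ κ ε (S ε)) =O[𝓝[>] 0] fun ε => D φ κ ε (S ε) := by
  obtain ⟨C₁, C₂, hC₁, h⟩ := hA2
  refine IsBigO.of_bound (√(2 * C₁))⁻¹ ?_
  filter_upwards [eventually_pos_nhdsGT] with ε hε
  have hA := (h ε hε).1
  rw [B, norm_div, Real.norm_of_nonneg (Real.sqrt_nonneg _), div_eq_inv_mul]
  gcongr

lemma tendsto_sub_of_orderLE {B x : ℝ → ℝ} (hB : Tendsto B (𝓝[>] 0) atTop)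
    (h : OrderLE B fun ε => B ε - x ε) : Tendsto (fun ε => B ε - x ε) (𝓝[>] 0) atTop := by
  obtain ⟨C, hC, hle⟩ := h
  refine tendsto_atTop_mono' _ ?_ (hB.atTop_div_const hC)
  filter_upwards [hle] with ε hε
  rw [div_le_iff₀ hC]; linarith

variable {Ω : Type*} [MeasurableSpace Ω] {P : Measure Ω} [IsProbabilityMeasure P]
  {W : Signal → Ω → ℝ} {φ : ℕ → Signal} {κ : ℝ → ℕ → ℝ}

lemma eventually_nearGaussian (hW : IsGaussianWhiteNoise W P)
    (hφ : Orthonormal ℝ (fun j : ℕ => φ (j + 1)))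
    (hκ : ∀ ε > 0, Summable (fun j : ℕ => κ ε (j + 1) ^ 2)) (hA1 : AssumptionA1 κ)
    (hA2 : AssumptionA2 κ) (S : ℝ → Signal) :
    ∀ᶠ ε in 𝓝[>] 0, NearGaussian P (centredStatistic W φ κ ε (S ε)) (weight κ ε 0)
      (B φ κ ε (S ε)) :=
  eventually_pos_nhdsGT.mono fun _ hε =>
    nearGaussian_centredStatistic hW hφ hκ hA1 hA2 hε _

lemma eventually_nearGaussian_null (hW : IsGaussianWhiteNoise W P)
    (hφ : Orthonormal ℝ (fun j : ℕ => φ (j + 1)))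
    (hκ : ∀ ε > 0, Summable (fun j : ℕ => κ ε (j + 1) ^ 2)) (hA1 : AssumptionA1 κ)
    (hA2 : AssumptionA2 κ) :
    ∀ᶠ ε in 𝓝[>] 0, NearGaussian P (centredStatistic W φ κ ε 0) (weight κ ε 0) 0 := by
  simpa only [B_zero] using eventually_nearGaussian hW hφ hκ hA1 hA2 fun _ => 0

/-- If the type I error vanishes, then the thresholds are positive. -/
lemma eventually_threshold_pos (hW : IsGaussianWhiteNoise W P)
    (hφ : Orthonormal ℝ (fun j : ℕ => φ (j + 1)))
    (hκ : ∀ ε > 0, Summable (fun j : ℕ => κ ε (j + 1) ^ 2)) (hA1 : AssumptionA1 κ)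
    (hA2 : AssumptionA2 κ) (hβ : Tendsto (fun ε => weight κ ε 0) (𝓝[>] 0) (𝓝 0)) {x : ℝ → ℝ}
    (hα : Tendsto (fun ε => typeI P W φ κ ε (x ε)) (𝓝[>] 0) (𝓝 0)) :
    ∀ᶠ ε in 𝓝[>] 0, 0 < x ε := by
  have hX := eventually_nearGaussian_null hW hφ hκ hA1 hA2
  obtain ⟨c, hc, hle⟩ := exists_pos_le_measureReal_pos hX hβ (by simp)
  filter_upwards [hX, hle, hα.eventually_lt_const hc, eventually_pos_nhdsGT] with ε h1 h2 h3 hε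
  by_contra hx
  rw [typeI_eq h1.aemeasurable hε] at h3
  -- A nonpositive threshold would make the null rejection probability at least `c`.
  have h4 : P.real {ω | 0 < centredStatistic W φ κ ε 0 ω} ≤
      P.real {ω | x ε < centredStatistic W φ κ ε 0 ω} :=
    measureReal_mono fun ω hω => (not_lt.1 hx).trans_lt hω
  linarith

/-- That `k → ∞` is not assumed: vanishing of the largest weight is deduced from the growth of the
signal or of `r`. -/
lemma tendsto_weight_zero_of_bounded {f : ℝ → ℝ}
    (hf : Tendsto f (𝓝[>] 0) atTop) {C : ℝ}
    (h : ∀ᶠ ε in 𝓝[>] 0, weight κ ε 0 * f ε ≤ C) :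
    Tendsto (fun ε => weight κ ε 0) (𝓝[>] 0) (𝓝 0) := by
  refine squeeze_zero' (Eventually.of_forall fun _ => weight_nonneg 0) ?_
    ((tendsto_const_nhds (x := C)).div_atTop hf)
  filter_upwards [h, hf.eventually_gt_atTop 0] with ε h1 h2
  rwa [le_div_iff₀ h2]

/-! ### The asymptotic statements for both error probabilities. -/

theorem isEquivalent_typeI (hW : IsGaussianWhiteNoise W P)
    (hφ : Orthonormal ℝ (fun j : ℕ => φ (j + 1)))
    (hκ : ∀ ε > 0, Summable (fun j : ℕ => κ ε (j + 1) ^ 2)) (hA1 : AssumptionA1 κ)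
    (hA2 : AssumptionA2 κ) (hA4 : AssumptionA4 κ) {x : ℝ → ℝ} (hx : Tendsto x (𝓝[>] 0) atTop)
    (hxk : x =o[𝓝[>] 0] (fun ε => (kIndex κ ε : ℝ) ^ (1 / 6 : ℝ))) :
    (fun ε => typeI P W φ κ ε (x ε)) ~[𝓝[>] 0] (fun ε => 1 - Phi (x ε)) := by
  have hX := eventually_nearGaussian_null hW hφ hκ hA1 hA2
  simp only [one_sub_Phi]
  refine isEquivalent_tail hX hx (tendsto_weight_zero_mul hA1 hA2 hA4 (isLittleO_pow_three hxk))
    (Eventually.of_forall fun _ => le_rfl) (by simp) ?_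
  filter_upwards [hX, eventually_pos_nhdsGT] with ε h hε
  exact Or.inl (typeI_eq h.aemeasurable hε _)

/-- Positivity of the threshold gives `B - x ≤ B`, so both error terms are at most `β B³ → 0`. -/
theorem isEquivalent_typeII (hW : IsGaussianWhiteNoise W P)
    (hφ : Orthonormal ℝ (fun j : ℕ => φ (j + 1)))
    (hκ : ∀ ε > 0, Summable (fun j : ℕ => κ ε (j + 1) ^ 2)) (hA1 : AssumptionA1 κ)
    (hA2 : AssumptionA2 κ) (hA4 : AssumptionA4 κ) {x : ℝ → ℝ} {S : ℝ → Signal}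
    (hα : Tendsto (fun ε => typeI P W φ κ ε (x ε)) (𝓝[>] 0) (𝓝 0))
    (hD : Tendsto (fun ε => D φ κ ε (S ε)) (𝓝[>] 0) atTop)
    (hDk : (fun ε => D φ κ ε (S ε)) =o[𝓝[>] 0] (fun ε => (kIndex κ ε : ℝ) ^ (1 / 6 : ℝ)))
    (hBx : OrderLE (fun ε => B φ κ ε (S ε)) (fun ε => B φ κ ε (S ε) - x ε)) :
    (fun ε => typeII P W φ κ ε (x ε) (S ε)) ~[𝓝[>] 0]
      (fun ε => Phi (x ε - B φ κ ε (S ε))) := by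
  have hX := eventually_nearGaussian hW hφ hκ hA1 hA2 S
  have hB := tendsto_B hA2 hD
  have hy := tendsto_sub_of_orderLE hB hBx
  have hB3 := tendsto_weight_zero_mul hA1 hA2 hA4
    (isLittleO_pow_three ((isBigO_B hA2 S).trans_isLittleO hDk))
  have hβ : Tendsto (fun ε => weight κ ε 0) (𝓝[>] 0) (𝓝 0) :=
    tendsto_weight_zero_of_bounded ((tendsto_pow_atTop three_ne_zero).comp hB)
      (hB3.eventually_le_const one_pos)
  have hxpos := eventually_threshold_pos hW hφ hκ hA1 hA2 hβ hα
  have hy3 : Tendsto (fun ε => weight κ ε 0 * (B φ κ ε (S ε) - x ε) ^ 3) (𝓝[>] 0) (𝓝 0) := by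
    refine squeeze_zero' ?_ ?_ hB3
    · filter_upwards [hy.eventually_ge_atTop 0] with ε h
      exact mul_nonneg (weight_nonneg 0) (pow_nonneg h 3)
    · filter_upwards [hy.eventually_ge_atTop 0, hxpos] with ε h h'
      exact mul_le_mul_of_nonneg_left (pow_le_pow_left₀ h (by linarith) 3) (weight_nonneg 0)
  have hyB : Tendsto (fun ε => weight κ ε 0 * (B φ κ ε (S ε) - x ε) ^ 2 * B φ κ ε (S ε))
      (𝓝[>] 0) (𝓝 0) := by
    refine squeeze_zero' ?_ ?_ hB3
    · exact Eventually.of_forall fun ε =>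
        mul_nonneg (mul_nonneg (weight_nonneg 0) (sq_nonneg _)) (B_nonneg _)
    · filter_upwards [hy.eventually_ge_atTop 0, hxpos] with ε h h'
      rw [pow_succ (B φ κ ε (S ε)) 2, ← mul_assoc]
      refine mul_le_mul_of_nonneg_right (mul_le_mul_of_nonneg_left ?_ (weight_nonneg 0))
        (B_nonneg _)
      exact pow_le_pow_left₀ h (by linarith) 2
  have hPhi : ∀ ε, Phi (x ε - B φ κ ε (S ε)) =
      (gaussianReal 0 1).real {v | B φ κ ε (S ε) - x ε < v} := fun ε => by
    rw [← neg_sub (B φ κ ε (S ε)), Phi_neg, measureReal_gaussianReal_Ici]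
  simp only [hPhi]
  refine isEquivalent_tail (hX.mono fun _ h => h.neg) hy hy3
    (Eventually.of_forall fun _ => B_nonneg _) hyB ?_
  filter_upwards [hX, eventually_pos_nhdsGT] with ε h hε
  exact Or.inr (typeII_eq h.aemeasurable hε _)

theorem isEquivalent_sqrt_log_typeI (hW : IsGaussianWhiteNoise W P)
    (hφ : Orthonormal ℝ (fun j : ℕ => φ (j + 1)))
    (hκ : ∀ ε > 0, Summable (fun j : ℕ => κ ε (j + 1) ^ 2)) (hA1 : AssumptionA1 κ)
    (hA2 : AssumptionA2 κ) (hA4 : AssumptionA4 κ) {x : ℝ → ℝ} (hx : Tendsto x (𝓝[>] 0) atTop)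
    (hxk : x =o[𝓝[>] 0] (fun ε => (kIndex κ ε : ℝ) ^ (1 / 2 : ℝ))) :
    (fun ε => √(2 * |Real.log (typeI P W φ κ ε (x ε))|)) ~[𝓝[>] 0] x ∧
      Tendsto (fun ε => typeI P W φ κ ε (x ε)) (𝓝[>] 0) (𝓝 0) := by
  have hX := eventually_nearGaussian_null hW hφ hκ hA1 hA2
  have heq : ∀ᶠ ε in 𝓝[>] 0, typeI P W φ κ ε (x ε) =
      P.real {ω | x ε < centredStatistic W φ κ ε 0 ω} := by
    filter_upwards [hX, eventually_pos_nhdsGT] with ε h hε using typeI_eq h.aemeasurable hε _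
  obtain ⟨hpos, hlog⟩ := tendsto_log_tail_div_sq hX hx
    (tendsto_weight_zero_mul hA1 hA2 hA4 hxk) (by simp) (heq.mono fun _ h => h.ge)
    (heq.mono fun ε h => h.le.trans (measureReal_mono fun ω (hω : x ε < _) => hω.le))
  exact ⟨isEquivalent_sqrt_abs_log hx hlog, tendsto_zero_of_tendsto_log_div_sq hx hpos hlog⟩

/-- On the logarithmic scale only `β B → 0` is needed; again `B - x ≤ B` controls the tail level. -/
theorem isEquivalent_sqrt_log_typeII (hW : IsGaussianWhiteNoise W P)
    (hφ : Orthonormal ℝ (fun j : ℕ => φ (j + 1)))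
    (hκ : ∀ ε > 0, Summable (fun j : ℕ => κ ε (j + 1) ^ 2)) (hA1 : AssumptionA1 κ)
    (hA2 : AssumptionA2 κ) (hA4 : AssumptionA4 κ) {x : ℝ → ℝ} {S : ℝ → Signal}
    (hα : Tendsto (fun ε => typeI P W φ κ ε (x ε)) (𝓝[>] 0) (𝓝 0))
    (hD : Tendsto (fun ε => D φ κ ε (S ε)) (𝓝[>] 0) atTop)
    (hDk : (fun ε => D φ κ ε (S ε)) =o[𝓝[>] 0] (fun ε => (kIndex κ ε : ℝ) ^ (1 / 2 : ℝ)))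
    (hBx : OrderLE (fun ε => B φ κ ε (S ε)) (fun ε => B φ κ ε (S ε) - x ε)) :
    (fun ε => √(2 * |Real.log (typeII P W φ κ ε (x ε) (S ε))|)) ~[𝓝[>] 0]
      (fun ε => B φ κ ε (S ε) - x ε) := by
  have hX := eventually_nearGaussian hW hφ hκ hA1 hA2 S
  have hB := tendsto_B hA2 hD
  have hy := tendsto_sub_of_orderLE hB hBx
  have hβB := tendsto_weight_zero_mul hA1 hA2 hA4 ((isBigO_B hA2 S).trans_isLittleO hDk)
  have hβ : Tendsto (fun ε => weight κ ε 0) (𝓝[>] 0) (𝓝 0) :=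
    tendsto_weight_zero_of_bounded hB (hβB.eventually_le_const one_pos)
  have hxpos := eventually_threshold_pos hW hφ hκ hA1 hA2 hβ hα
  have hβy : Tendsto (fun ε => weight κ ε 0 * (B φ κ ε (S ε) - x ε)) (𝓝[>] 0) (𝓝 0) := by
    refine squeeze_zero' ?_ ?_ hβB
    · filter_upwards [hy.eventually_ge_atTop 0] with ε h
      exact mul_nonneg (weight_nonneg 0) h
    · filter_upwards [hxpos] with ε h
      exact mul_le_mul_of_nonneg_left (by linarith) (weight_nonneg 0)
  have heq : ∀ᶠ ε in 𝓝[>] 0, typeII P W φ κ ε (x ε) (S ε) =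
      P.real {ω | B φ κ ε (S ε) - x ε ≤ -centredStatistic W φ κ ε (S ε) ω} := by
    filter_upwards [hX, eventually_pos_nhdsGT] with ε h hε using typeII_eq h.aemeasurable hε _
  obtain ⟨-, hlog⟩ := tendsto_log_tail_div_sq (hX.mono fun _ h => h.neg) hy hβy hβB
    (heq.mono fun ε h => h.ge.trans' (measureReal_mono fun ω
      (hω : B φ κ ε (S ε) - x ε < _) => hω.le))
    (heq.mono fun _ h => h.le)
  exact isEquivalent_sqrt_abs_log hy hlog

/-- Chernoff's bound at `t = η r` gains at least `tB/C`. The noncentral error `4βt²B` costs at most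
half of that, and the other terms are `O(r²)`, so `r⁻² |log β|` is at least a multiple of `B/r`
minus a constant. -/
theorem tendsto_log_typeII_div_sq (hW : IsGaussianWhiteNoise W P)
    (hφ : Orthonormal ℝ (fun j : ℕ => φ (j + 1)))
    (hκ : ∀ ε > 0, Summable (fun j : ℕ => κ ε (j + 1) ^ 2)) (hA1 : AssumptionA1 κ)
    (hA2 : AssumptionA2 κ) (hA4 : AssumptionA4 κ) {x : ℝ → ℝ} {S : ℝ → Signal} {r : ℝ → ℝ}
    (hα : Tendsto (fun ε => typeI P W φ κ ε (x ε)) (𝓝[>] 0) (𝓝 0))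
    (hr : Tendsto r (𝓝[>] 0) atTop)
    (hrk : OrderLE r (fun ε => (kIndex κ ε : ℝ) ^ (1 / 2 : ℝ)))
    (hBr : Tendsto (fun ε => B φ κ ε (S ε) / r ε) (𝓝[>] 0) atTop)
    (hBx : OrderLE (fun ε => B φ κ ε (S ε)) (fun ε => B φ κ ε (S ε) - x ε)) :
    Tendsto (fun ε => (r ε ^ 2)⁻¹ * |Real.log (typeII P W φ κ ε (x ε) (S ε))|)
      (𝓝[>] 0) atTop := by
  have hX := eventually_nearGaussian hW hφ hκ hA1 hA2 S
  obtain ⟨C, hC, hCle⟩ := hBx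
  obtain ⟨C', hC', hC'le⟩ := hrk
  obtain ⟨K, hK, hKle⟩ := exists_weight_zero_mul_le hA1 hA2 hA4
  set M := C' * K
  have hM : 0 < M := mul_pos hC' hK
  have hβr : ∀ᶠ ε in 𝓝[>] 0, weight κ ε 0 * r ε ≤ M := by
    filter_upwards [hC'le, hKle] with ε h1 h2
    calc weight κ ε 0 * r ε ≤ weight κ ε 0 * (C' * (kIndex κ ε : ℝ) ^ (1 / 2 : ℝ)) :=
          mul_le_mul_of_nonneg_left h1 (weight_nonneg 0)
      _ = C' * (weight κ ε 0 * (kIndex κ ε : ℝ) ^ (1 / 2 : ℝ)) := by ring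
      _ ≤ C' * K := by gcongr
  have hxpos := eventually_threshold_pos hW hφ hκ hA1 hA2
    (tendsto_weight_zero_of_bounded hr hβr) hα
  -- The first entry keeps `t` in the range `tβ ≤ 1/4` of the cumulant bound; the second limits the
  -- noncentral error to half of the gain.
  set η := min (1 / (4 * M)) (1 / (8 * M * C))
  have hη : 0 < η := lt_min (by positivity) (by positivity)
  have hη1 : η * M ≤ 1 / 4 := by
    have := mul_le_mul_of_nonneg_right (min_le_left (1 / (4 * M)) (1 / (8 * M * C))) hM.le
    refine this.trans_eq ?_
    field_simp
  have hη2 : 4 * η * M ≤ 1 / (2 * C) := by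
    have := mul_le_mul_of_nonneg_right (min_le_right (1 / (4 * M)) (1 / (8 * M * C)))
      (by positivity : 0 ≤ 4 * M)
    refine (le_of_eq (by ring)).trans (this.trans_eq ?_)
    field_simp
    norm_num
  have hlim : Tendsto (fun ε => η / (2 * C) * (B φ κ ε (S ε) / r ε) +
      -(η ^ 2 / 2 + 2 * η ^ 3 * M)) (𝓝[>] 0) atTop :=
    tendsto_atTop_add_const_right _ _ (hBr.const_mul_atTop (by positivity))
  refine tendsto_atTop_mono' _ ?_ hlim
  filter_upwards [hX, hβr, hxpos, hCle, hr.eventually_gt_atTop 0, eventually_pos_nhdsGT]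
    with ε hXε hβε hxε hCε hrε hε
  set b := weight κ ε 0
  set B₀ := B φ κ ε (S ε)
  have hB₀ : 0 ≤ B₀ := B_nonneg _
  have hb : 0 ≤ b := weight_nonneg 0
  set p := typeII P W φ κ ε (x ε) (S ε)
  have hp : 0 < p := typeII_pos hW hφ hκ hA1 hA2 hε _ hxε
  set t := η * r ε
  have ht : 0 < t := mul_pos hη hrε
  have htb : t * b ≤ η * M := by
    calc t * b = η * (b * r ε) := by ring
      _ ≤ η * M := by gcongr
  have ht4 : |t| * b ≤ 1 / 4 := by rw [abs_of_pos ht]; exact htb.trans hη1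
  have hneg := hXε.neg
  have hcgf := (abs_le.1 (hneg.mgf_eq_exp_cgf ht4).2).2
  have hchern := measure_ge_le_exp_cgf (X := fun ω => -centredStatistic W φ κ ε (S ε) ω) (μ := P)
    (B₀ - x ε) ht.le (hneg.integrable_exp _ ht4)
  have hlogp : Real.log p ≤ -t * (B₀ - x ε) +
      cgf (fun ω => -centredStatistic W φ κ ε (S ε) ω) P t := by
    rw [← Real.log_exp (-t * (B₀ - x ε) + _)]
    refine Real.log_le_log hp ?_
    exact (typeII_eq hXε.aemeasurable hε _).le.trans hchern
  rw [abs_of_pos ht] at hcgf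
  have h1 : t * (B₀ / C) ≤ t * (B₀ - x ε) := by
    gcongr
    rw [div_le_iff₀ hC]
    linarith
  have h2 : b * (2 * t ^ 3) ≤ 2 * η ^ 3 * M * r ε ^ 2 := by
    calc b * (2 * t ^ 3) = 2 * t ^ 2 * (t * b) := by ring
      _ ≤ 2 * t ^ 2 * (η * M) := by gcongr
      _ = _ := by simp only [t]; ring
  have h3 : b * (4 * t ^ 2 * B₀) ≤ t * B₀ * (1 / (2 * C)) := by
    calc b * (4 * t ^ 2 * B₀) = t * B₀ * (4 * (t * b)) := by ring
      _ ≤ t * B₀ * (4 * (η * M)) := by gcongr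
      _ ≤ _ := by
        refine mul_le_mul_of_nonneg_left ?_ (by positivity)
        linarith
  have h4 : t * (B₀ / C) = t * B₀ * (1 / (2 * C)) + t * B₀ * (1 / (2 * C)) := by
    field_simp; norm_num
  have h5 : t * B₀ * (1 / (2 * C)) - t ^ 2 / 2 - 2 * η ^ 3 * M * r ε ^ 2 ≤ |Real.log p| := by
    refine le_trans ?_ (neg_le_abs _)
    linarith
  rw [inv_mul_eq_div, le_div_iff₀ (by positivity)]
  refine le_trans (le_of_eq ?_) h5
  simp only [t]
  field_simp
  ring

end NeymanTest

open NeymanTest in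
theorem mainTheorem9 {Ω : Type*} [MeasurableSpace Ω] (P : Measure Ω) [IsProbabilityMeasure P]
    (W : Signal → Ω → ℝ) (hW : IsGaussianWhiteNoise W P)
    (φ : ℕ → Signal) (hφ : Orthonormal ℝ (fun j : ℕ => φ (j + 1)))
    (κ : ℝ → ℕ → ℝ) (hκ : ∀ ε > 0, Summable (fun j : ℕ => κ ε (j + 1) ^ 2))
    (hA1 : AssumptionA1 κ) (hA2 : AssumptionA2 κ) (hA3 : AssumptionA3 κ) (hA4 : AssumptionA4 κ) :
    -- type I error, sharp asymptotics
    (∀ x : ℝ → ℝ, Tendsto x (𝓝[>] 0) atTop →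
      x =o[𝓝[>] 0] (fun ε => (kIndex κ ε : ℝ) ^ (1 / 6 : ℝ)) →
      (fun ε => typeI P W φ κ ε (x ε)) ~[𝓝[>] 0] (fun ε => 1 - Phi (x ε))) ∧
    -- type II error, sharp asymptotics
    (∀ (x : ℝ → ℝ) (S : ℝ → Signal),
      Tendsto (fun ε => typeI P W φ κ ε (x ε)) (𝓝[>] 0) (𝓝 0) →
      OrderLE x (fun ε => B φ κ ε (S ε)) →
      Tendsto (fun ε => D φ κ ε (S ε)) (𝓝[>] 0) atTop →
      (fun ε => D φ κ ε (S ε)) =o[𝓝[>] 0] (fun ε => (kIndex κ ε : ℝ) ^ (1 / 6 : ℝ)) →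
      OrderLE (fun ε => B φ κ ε (S ε)) (fun ε => B φ κ ε (S ε) - x ε) →
      (fun ε => typeII P W φ κ ε (x ε) (S ε)) ~[𝓝[>] 0]
        (fun ε => Phi (x ε - B φ κ ε (S ε)))) ∧
    -- type I error, logarithmic asymptotics
    (∀ x : ℝ → ℝ, Tendsto x (𝓝[>] 0) atTop →
      x =o[𝓝[>] 0] (fun ε => (kIndex κ ε : ℝ) ^ (1 / 2 : ℝ)) →
      (fun ε => √(2 * |Real.log (typeI P W φ κ ε (x ε))|)) ~[𝓝[>] 0] x ∧
      Tendsto (fun ε => typeI P W φ κ ε (x ε)) (𝓝[>] 0) (𝓝 0)) ∧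
    -- type II error, logarithmic asymptotics
    (∀ (x : ℝ → ℝ) (S : ℝ → Signal),
      Tendsto (fun ε => typeI P W φ κ ε (x ε)) (𝓝[>] 0) (𝓝 0) →
      OrderLE x (fun ε => B φ κ ε (S ε)) →
      Tendsto (fun ε => D φ κ ε (S ε)) (𝓝[>] 0) atTop →
      (fun ε => D φ κ ε (S ε)) =o[𝓝[>] 0] (fun ε => (kIndex κ ε : ℝ) ^ (1 / 2 : ℝ)) →
      OrderLE (fun ε => B φ κ ε (S ε)) (fun ε => B φ κ ε (S ε) - x ε) →
      (fun ε => √(2 * |Real.log (typeII P W φ κ ε (x ε) (S ε))|)) ~[𝓝[>] 0]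
        (fun ε => B φ κ ε (S ε) - x ε)) ∧
    -- type II error, signals of larger order
    (∀ (x : ℝ → ℝ) (S : ℝ → Signal) (r : ℝ → ℝ),
      Tendsto (fun ε => typeI P W φ κ ε (x ε)) (𝓝[>] 0) (𝓝 0) →
      OrderLE x (fun ε => B φ κ ε (S ε)) →
      Tendsto r (𝓝[>] 0) atTop →
      OrderLE r (fun ε => (kIndex κ ε : ℝ) ^ (1 / 2 : ℝ)) →
      Tendsto (fun ε => B φ κ ε (S ε) / r ε) (𝓝[>] 0) atTop →
      OrderLE (fun ε => B φ κ ε (S ε)) (fun ε => B φ κ ε (S ε) - x ε) →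
      Tendsto (fun ε => (r ε ^ 2)⁻¹ * |Real.log (typeII P W φ κ ε (x ε) (S ε))|)
        (𝓝[>] 0) atTop) := by
  exact ⟨fun x hx hxk => isEquivalent_typeI hW hφ hκ hA1 hA2 hA4 hx hxk,
    fun x S hα _ hD hDk hBx => isEquivalent_typeII hW hφ hκ hA1 hA2 hA4 hα hD hDk hBx,
    fun x hx hxk => isEquivalent_sqrt_log_typeI hW hφ hκ hA1 hA2 hA4 hx hxk,
    fun x S hα _ hD hDk hBx => isEquivalent_sqrt_log_typeII hW hφ hκ hA1 hA2 hA4 hα hD hDk hBx,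
    fun x S r hα _ hr hrk hBr hBx =>
      tendsto_log_typeII_div_sq hW hφ hκ hA1 hA2 hA4 hα hr hrk hBr hBx⟩
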